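/- Let $N,d\ge 1$ be integers, $D=\{1,\dots,d\}$, $\lambda,\mu>0$, and let $C=(c_{l,j})_{l,j\in D}$ be a stochastic matrix. Consider a system holding at most $N$ particles, all present particles being of the same type in $D$. Let $\mathcal N(t)$ be the number of particles at time $t$; let $\mathcal L(t)$ be their type if $\mathcal N(t)\ge 1$; and, when the system is empty, let $\mathcal J(t)$ be the type of the last particle that was in the system. The system evolves as a time-homogeneous continuous-time Markov chain on the states $(k,j)$, $1\le k\le N$, $j\in D$ ($k$ particles of type $j$), and $(0,l)$, $l\in D$ (empty, last type $l$), with transition rates $$(k,j)\to(k-1,j):\ \mu(N+k),\qquad (k,j)\to(k+1,j):\ \lambda(N-k)\qquad (1\le k\le N),\qquad (0,l)\to(1,j):\ c_{l,j}\lambda N,$$ all other rates being zero. Fix $l_0\in D$ such that the initial state is $(0,l_0)$ with positive probability, and put $$p(r,t)=\mathbb P\{\mathcal N(t)=r\mid \mathcal N(0)=0,\ \mathcal J(0)=l_0\}.$$ Let $$Q(x)=\prod_{r=0}^{N-1}\bigl[x+2\mu(2r+1)\bigr],\qquad P(x)=x\left[\prod_{r=0}^{N-1}\bigl(x+2\mu(2r+1)\bigr)+\prod_{r=0}^{N-1}\bigl(x+2\mu(2r+2)\bigr)\right].$$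 Then $P$ has exactly $N+1$ real roots $0=\alpha_1>\alpha_2>\dots>\alpha_{N+1}$. Put $$\beta_k=\lim_{\eta\to\alpha_k}\frac{P(\eta)}{\eta-\alpha_k}=2\prod_{s\ne k}(\alpha_k-\alpha_s),\qquad R(\alpha_k)=\frac{Q(\alpha_k)}{\beta_k}\qquad(k=1,\dots,N+1).$$ If $\lambda=\mu$, then all the denominators below and all $\beta_k$ are nonzero and, for all $t\ge 0$ and $r=1,\dots,N$, $$\begin{aligned} p(r,t)={}&\frac1{4^N}\binom{2N}{N+r}\sum_{l=0}^N\binom Nl\left(-e^{-4\mu t}\right)^l{}_2F_1(-2l,-N+r;-2N;2)\\ &+\frac{\mu N}{2^{2N-2}}(-1)^{N-r}\sum_{j=0}^{N-1}\binom{N-1}{j}(-1)^{N-1-j}\\ &\quad\times\left\{\binom{2N-1}{N+r}{}_2F_1(-2j,-N+r+1;-2N+1;2)-\binom{2N-1}{N+r-1}{}_2F_1(-2j,-N+r;-2N+1;2)\right\}\\ &\quad\times\left\{\sum_{k=1}^{N+1}\frac{R(\alpha_k)e^{-|\alpha_k|t}}{|\alpha_k|-2\mu(2N-1-2j)}-e^{-2\mu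 t(2N-1-2j)}\sum_{k=1}^{N+1}\frac{R(\alpha_k)}{|\alpha_k|-2\mu(2N-1-2j)}\right\}\\ &+\frac{\mu N}{2^{2N-2}}(-1)^{N-r}\binom{2N}{N+r}\sum_{j=0}^{N-1}\binom{N-1}{j}(-1)^{N-1-j}{}_2F_1(-2j,-N+r;-2N;2)\\ &\quad\times\left\{\sum_{k=1}^{N+1}\frac{R(\alpha_k)e^{-|\alpha_k|t}}{|\alpha_k|-4\mu(N-j)}-e^{-4\mu t(N-j)}\sum_{k=1}^{N+1}\frac{R(\alpha_k)}{|\alpha_k|-4\mu(N-j)}\right\}, \end{aligned}$$ where ${}_2F_1(a,b;c;z)=\sum_{n\ge0}\frac{(a)_n(b)_n}{(c)_n}\frac{z^n}{n!}$ is the Gauss hypergeometric function; every such series above terminates (at the first $n$ with $(a)_n(b)_n=0$). -/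

import Mathlib

open Filter Topology MeasureTheory
open scoped NNReal BigOperators

noncomputable section

namespace Ehrenfest

/-- `P h a b` is a (standard) transition function on the finite set `S`: every `P h` is a
stochastic matrix, `P 0` is the identity, and the Chapman-Kolmogorov equations hold. -/
structure IsTransitionFunction {S : Type*} [Fintype S] [DecidableEq S]
    (P : ℝ≥0 → Matrix S S ℝ) : Prop where
  nonneg : ∀ h a b, 0 ≤ P h a b
  row_sum : ∀ h a, ∑ b, P h a b = 1
  zero : P 0 = 1
  add : ∀ h h', P (h + h') = P h * P h'

/-- The `σ`-algebra generated by the process `X` up to and including time `s`. -/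
def past {Ω S : Type*} [MeasurableSpace S] (X : ℝ≥0 → Ω → S) (s : ℝ≥0) : MeasurableSpace Ω :=
  ⨆ u ∈ Set.Iic s, MeasurableSpace.comap (X u) inferInstance

/-- `X` is a (time-homogeneous) continuous-time Markov chain under `ℙ`, on the finite state space
`S`, with transition rates `q a b` for `a ≠ b`: there is a transition function `P` with
`P h a b = q a b * h + o(h)` as `h → 0+` for `a ≠ b`, such that, given the whole past up to time `s`
and `X s = a`, one has `X (s + h) = b` with probability `P h a b`.
The diagonal values of `q` play no role. -/
def IsMarkovChainWithRates {Ω S : Type*} [MeasurableSpace Ω] [Fintype S] [DecidableEq S]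
    [MeasurableSpace S] (q : S → S → ℝ) (ℙ : Measure Ω) (X : ℝ≥0 → Ω → S) : Prop :=
  (∀ t, Measurable (X t)) ∧
  ∃ P : ℝ≥0 → Matrix S S ℝ, IsTransitionFunction P ∧
    (∀ a b, a ≠ b → Tendsto (fun h : ℝ≥0 => P h a b / (h : ℝ)) (𝓝[>] 0) (𝓝 (q a b))) ∧
    (∀ (s h : ℝ≥0) (A : Set Ω), MeasurableSet[past X s] A → ∀ a b : S,
      ℙ.real (A ∩ {ω | X s ω = a} ∩ {ω | X (s + h) ω = b})
        = ℙ.real (A ∩ {ω | X s ω = a}) * P h a b)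

/-- States of the multi-type Ehrenfest model with at most `N` particles and `d` types.
`(k, j)` with `k ≥ 1`: there are `k` particles in the system, all of type `j`.
`(0, l)`: the system is empty and the last particle in it was of type `l`. -/
abbrev State (N d : ℕ) : Type := Fin (N + 1) × Fin d

/-- Transition rates of the multi-type Ehrenfest model (off the diagonal):
`(k, j) → (k - 1, j)` at rate `μ (N + k)` and `(k, j) → (k + 1, j)` at rate `λ (N - k)`
for `1 ≤ k ≤ N`; `(0, l) → (1, j)` at rate `c l j * λ * N`; all other rates are zero. -/
def rate (N d : ℕ) (lam mu : ℝ) (c : Fin d → Fin d → ℝ) (a b : State N d) : ℝ :=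
  if a.1.val = 0 then
    if b.1.val = 1 then c a.2 b.2 * lam * N else 0
  else if b.2 = a.2 then
    if b.1.val + 1 = a.1.val then mu * ((N : ℝ) + a.1.val)
    else if b.1.val = a.1.val + 1 then lam * ((N : ℝ) - a.1.val)
    else 0
  else 0

/-- `c` is a stochastic matrix. -/
def IsStochastic {d : ℕ} (c : Fin d → Fin d → ℝ) : Prop :=
  (∀ l j, 0 ≤ c l j) ∧ ∀ l, ∑ j, c l j = 1

/-- `p(r, t)`: the conditional probability that the system contains `r` particles at time `t`, given
that at time `0` it is empty and the last particle in it was of type `l₀`. -/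
def prob {N d : ℕ} {Ω : Type*} [MeasurableSpace Ω] (ℙ : Measure Ω) (X : ℝ≥0 → Ω → State N d)
    (l₀ : Fin d) (r : ℕ) (t : ℝ≥0) : ℝ :=
  (ProbabilityTheory.cond ℙ {ω | X 0 ω = (0, l₀)}).real {ω | (X t ω).1.val = r}

/-- `Q(x) = ∏_{r=0}^{N-1} (x + 2μ(2r+1))`. -/
def polyQ (N : ℕ) (mu : ℝ) (x : ℝ) : ℝ :=
  ∏ r ∈ Finset.range N, (x + 2 * mu * (2 * (r : ℝ) + 1))

/-- `P(x) = x [∏_{r=0}^{N-1} (x + 2μ(2r+1)) + ∏_{r=0}^{N-1} (x + 2μ(2r+2))]`. -/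
def polyP (N : ℕ) (mu : ℝ) (x : ℝ) : ℝ :=
  x * (∏ r ∈ Finset.range N, (x + 2 * mu * (2 * (r : ℝ) + 1))
    + ∏ r ∈ Finset.range N, (x + 2 * mu * (2 * (r : ℝ) + 2)))

end Ehrenfest

end

/-! Since `c` is stochastic, the particle count is itself a Markov chain, with generator `gen`. For
equal rates it is, away from `0`, the Ehrenfest walk of `2 * N` balls with `N + b` of them in one
urn. At `0` only the jump to `-1` is missing.

The Krawtchouk values (coefficient `m` of `(1 + X)^(N + b) * (1 - X)^(N - b)`) are eigenfunctions of
the full walk, with eigenvalue `-2μm`, so under `gen` they acquire a defect at `0` only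
(`gen_krawtchouk`). Their expectations therefore solve linear equations forced by the probability of
emptiness (`IsOccupation.moment`), and Krawtchouk inversion (`eq_sum_krawtchouk`) recovers `p(r, t)`
from them.

The probability of emptiness comes from genuine eigenfunctions of `gen`. Solving the eigenvalue
equation downwards from level `N` gives the polynomials `decayPoly` in the eigenvalue, and the
equation at `0` becomes `polyP = 0`. The Krawtchouk zeros factor both terms of that equation
(`decayPoly_eq_oddProd`, `decayPoly_eq_evenProd`). Summing the eigenfunction expectations with
Lagrange weights isolates level `0` (`IsOccupation.empty`).

Expanding Krawtchouk values as terminating `₂F₁` series gives the stated form. -/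

namespace Ehrenfest

/-! ### Forward equation for a finite transition function -/

section TransitionFunction

/-- The diagonal of `q` is unspecified, so `g` must vanish there. -/
theorem tendsto_rate_mul {S : Type*} {P : ℝ≥0 → Matrix S S ℝ} {q : S → S → ℝ}
    (hq : ∀ a b, a ≠ b → Tendsto (fun h : ℝ≥0 => P h a b / (h : ℝ)) (𝓝[>] 0) (𝓝 (q a b)))
    (g : S → S → ℝ) (hg : ∀ b, g b b = 0) (b b' : S) :
    Tendsto (fun h : ℝ≥0 => P h b b' / (h : ℝ) * g b b') (𝓝[>] 0) (𝓝 (q b b' * g b b')) := by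
  rcases eq_or_ne b b' with rfl | hne
  · simp [hg]
  · exact (hq b b' hne).mul_const _

variable {S : Type*} [Fintype S] [DecidableEq S] {P : ℝ≥0 → Matrix S S ℝ} {q : S → S → ℝ}

/-- Chapman-Kolmogorov, with the unit row sums used to write everything through differences of `f`,
so that diagonal rates never enter. -/
theorem IsTransitionFunction.increment (hP : IsTransitionFunction P) (a : S) (f : S → ℝ)
    (t h : ℝ≥0) :
    ∑ b, P (t + h) a b * f b - ∑ b, P t a b * f b
      = ∑ b, P t a b * ∑ b', P h b b' * (f b' - f b) := by
  have h1 : ∀ b, ∑ b', P h b b' * (f b' - f b) = ∑ b', P h b b' * f b' - f b := by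
    intro b
    simp only [mul_sub, Finset.sum_sub_distrib, ← Finset.sum_mul, hP.row_sum, one_mul]
  simp_rw [h1]
  simp only [mul_sub, Finset.sum_sub_distrib]
  congr 1
  simp only [hP.add, Matrix.mul_apply, Finset.sum_mul, Finset.mul_sum]
  rw [Finset.sum_comm]
  simp only [mul_assoc]

theorem IsTransitionFunction.le_one (hP : IsTransitionFunction P) (h : ℝ≥0) (a b : S) :
    P h a b ≤ 1 := by
  rw [← hP.row_sum h a]
  exact Finset.single_le_sum (fun b _ => hP.nonneg h a b) (Finset.mem_univ b)

/-- The expected oscillation of `f` over a time span `h`, summed over all starting points. -/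
noncomputable def oscillation (P : ℝ≥0 → Matrix S S ℝ) (f : S → ℝ) (h : ℝ≥0) : ℝ :=
  ∑ b, ∑ b', P h b b' * |f b' - f b|

theorem IsTransitionFunction.tendsto_oscillation (hP : IsTransitionFunction P)
    (hq : ∀ a b, a ≠ b → Tendsto (fun h : ℝ≥0 => P h a b / (h : ℝ)) (𝓝[>] 0) (𝓝 (q a b)))
    (f : S → ℝ) : Tendsto (oscillation P f) (𝓝 0) (𝓝 0) := by
  have hset : (Set.univ : Set ℝ≥0) = insert 0 (Set.Ioi 0) := by
    ext x
    simp
  -- The rates control only `h > 0`; the point `h = 0` is treated separately, through `P 0 = 1`.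
  rw [← nhdsWithin_univ (0 : ℝ≥0), hset, nhdsWithin_insert, tendsto_sup]
  have h0 : oscillation P f 0 = 0 := by
    refine Finset.sum_eq_zero fun b _ => Finset.sum_eq_zero fun b' _ => ?_
    rcases eq_or_ne b b' with rfl | hne
    · simp
    · simp [hP.zero, Matrix.one_apply_ne hne]
  refine ⟨by rw [tendsto_pure_left]; intro s hs; rw [h0]; exact mem_of_mem_nhds hs, ?_⟩
  have hid : Tendsto (fun h : ℝ≥0 => (h : ℝ)) (𝓝[>] 0) (𝓝 0) := by
    have : Tendsto (fun h : ℝ≥0 => (h : ℝ)) (𝓝 0) (𝓝 ((0 : ℝ≥0) : ℝ)) :=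
      NNReal.continuous_coe.tendsto 0
    exact this.mono_left nhdsWithin_le_nhds
  have hsum := tendsto_finsetSum Finset.univ fun b _ => tendsto_finsetSum Finset.univ fun b' _ =>
    (tendsto_rate_mul hq (fun b b' => |f b' - f b|) (by simp) b b').mul hid
  simp only [mul_zero, Finset.sum_const_zero] at hsum
  refine hsum.congr' ?_
  filter_upwards [self_mem_nhdsWithin] with h hh
  have : (h : ℝ) ≠ 0 := by simpa using (ne_of_gt hh)
  refine Finset.sum_congr rfl fun b _ => Finset.sum_congr rfl fun b' _ => ?_
  field_simp

theorem IsTransitionFunction.abs_increment_le (hP : IsTransitionFunction P) (a : S) (f : S → ℝ)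
    (t h : ℝ≥0) :
    |∑ b, P (t + h) a b * f b - ∑ b, P t a b * f b| ≤ oscillation P f h := by
  rw [hP.increment]
  refine (Finset.abs_sum_le_sum_abs _ _).trans (Finset.sum_le_sum fun b _ => ?_)
  rw [abs_mul, abs_of_nonneg (hP.nonneg t a b)]
  refine (mul_le_of_le_one_left (abs_nonneg _) (hP.le_one t a b)).trans ?_
  refine (Finset.abs_sum_le_sum_abs _ _).trans (Finset.sum_le_sum fun b' _ => ?_)
  rw [abs_mul, abs_of_nonneg (hP.nonneg h b b')]

/-- The oscillation bound is uniform in the base time, so taking the earlier of the two times as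
base gives continuity from both sides. Uniqueness from a right derivative needs this. -/
theorem IsTransitionFunction.continuous_expect (hP : IsTransitionFunction P)
    (hq : ∀ a b, a ≠ b → Tendsto (fun h : ℝ≥0 => P h a b / (h : ℝ)) (𝓝[>] 0) (𝓝 (q a b)))
    (a : S) (f : S → ℝ) : Continuous fun x : ℝ≥0 => ∑ b, P x a b * f b := by
  rw [continuous_iff_continuousAt]
  intro t
  have key : ∀ s : ℝ≥0, |∑ b, P s a b * f b - ∑ b, P t a b * f b|
      ≤ oscillation P f (nndist s t) := by
    intro s
    rcases le_total t s with h | h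
    · have : s = t + nndist s t := by
        apply NNReal.coe_injective
        have h' : (t : ℝ) ≤ s := h
        rw [NNReal.coe_add, coe_nndist, NNReal.dist_eq, abs_of_nonneg (sub_nonneg.2 h')]
        ring
      conv_lhs => rw [this]
      exact hP.abs_increment_le a f t _
    · have : t = s + nndist s t := by
        apply NNReal.coe_injective
        have h' : (s : ℝ) ≤ t := h
        rw [NNReal.coe_add, coe_nndist, NNReal.dist_eq, abs_of_nonpos (sub_nonpos.2 h')]
        ring
      rw [abs_sub_comm]
      conv_lhs => rw [this]
      exact hP.abs_increment_le a f s _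
  have hd : Tendsto (fun s : ℝ≥0 => nndist s t) (𝓝 t) (𝓝 0) := by
    have : Continuous fun s : ℝ≥0 => nndist s t := by fun_prop
    simpa using this.tendsto t
  have hlim := (hP.tendsto_oscillation hq f).comp hd
  rw [ContinuousAt, tendsto_iff_dist_tendsto_zero]
  exact squeeze_zero (fun _ => dist_nonneg) (fun s => by rw [Real.dist_eq]; exact key s) hlim

theorem IsTransitionFunction.hasDerivWithinAt_expect (hP : IsTransitionFunction P)
    (hq : ∀ a b, a ≠ b → Tendsto (fun h : ℝ≥0 => P h a b / (h : ℝ)) (𝓝[>] 0) (𝓝 (q a b)))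
    (a : S) (f : S → ℝ) (x : ℝ) (hx : 0 ≤ x) :
    HasDerivWithinAt (fun x : ℝ => ∑ b, P x.toNNReal a b * f b)
      (∑ b, P x.toNNReal a b * ∑ b', q b b' * (f b' - f b)) (Set.Ici x) x := by
  rw [hasDerivWithinAt_iff_tendsto_slope, Set.Ici_sdiff_left]
  have hd : Tendsto (fun y : ℝ => (y - x).toNNReal) (𝓝[>] x) (𝓝[>] 0) := by
    refine tendsto_nhdsWithin_iff.2 ⟨?_, ?_⟩
    · have : Continuous fun y : ℝ => (y - x).toNNReal := by fun_prop
      have h := this.tendsto x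
      simp only [sub_self, Real.toNNReal_zero] at h
      exact h.mono_left nhdsWithin_le_nhds
    · filter_upwards [self_mem_nhdsWithin] with y hy
      simpa using hy
  have hsum := tendsto_finsetSum Finset.univ fun b _ => (tendsto_finsetSum Finset.univ fun b' _ =>
    tendsto_rate_mul hq (fun b b' => f b' - f b) (by simp) b b').const_mul (P x.toNNReal a b)
  refine (hsum.comp hd).congr' ?_
  filter_upwards [self_mem_nhdsWithin] with y hy
  have hy' : 0 ≤ y - x := sub_nonneg.2 (le_of_lt hy)
  have hadd : y.toNNReal = x.toNNReal + (y - x).toNNReal := by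
    rw [← Real.toNNReal_add hx hy', add_sub_cancel]
  simp only [Function.comp, slope_def_field]
  rw [hadd, hP.increment, Real.coe_toNNReal _ hy', Finset.sum_div]
  refine Finset.sum_congr rfl fun b _ => ?_
  rw [mul_div_assoc, Finset.sum_div]
  congr 1
  refine Finset.sum_congr rfl fun b' _ => ?_
  ring

end TransitionFunction

/-! ### Linear equations and reduction to the particle count -/

/-- Uniqueness for the linear equation `u' = -c u + φ` with a right derivative on `[0, ∞)`. -/
theorem eq_of_hasDerivWithinAt_linear {u w φ : ℝ → ℝ} {c : ℝ} (hu : Continuous u)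
    (hu' : ∀ x, 0 ≤ x → HasDerivWithinAt u (-c * u x + φ x) (Set.Ici x) x)
    (hw : ∀ x, HasDerivAt w (-c * w x + φ x) x)
    (h0 : u 0 = w 0) (t : ℝ) (ht : 0 ≤ t) : u t = w t := by
  have hcw : Continuous w := continuous_iff_continuousAt.2 fun x => (hw x).continuousAt
  have hexp : ∀ x, HasDerivAt (fun x => Real.exp (c * x)) (Real.exp (c * x) * c) x := fun x => by
    simpa using ((hasDerivAt_id x).const_mul c).exp
  have hcont : ContinuousOn (fun x => Real.exp (c * x) * (u x - w x)) (Set.Icc 0 t) := by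
    fun_prop
  -- Integrating factor: `exp (c * x) * (u x - w x)` has right derivative zero.
  have := constant_of_has_deriv_right_zero hcont (fun x hx => by
    refine ((hexp x).hasDerivWithinAt.mul ((hu' x hx.1).sub
      (hw x).hasDerivWithinAt)).congr_deriv ?_
    simp only [Pi.sub_apply]
    ring) t ⟨ht, le_rfl⟩
  simp only [h0, sub_self, mul_zero, mul_eq_zero, Real.exp_ne_zero, false_or] at this
  linarith

/-- The generator, acting on functions of the number of particles, for equal birth and death
parameters. -/
def gen (N : ℕ) (mu : ℝ) (f : ℕ → ℝ) (b : ℕ) : ℝ :=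
  if b = 0 then mu * N * (f 1 - f 0)
  else mu * (N + b) * (f (b - 1) - f b) + mu * (N - b) * (f (b + 1) - f b)

/-- Lumpability: types never change above level `0`, and the total rate out of `(0, l)` does not
depend on `l` because each row of `c` sums to one. -/
theorem sum_rate_mul {N d : ℕ} (hN : 1 ≤ N) {mu : ℝ} {c : Fin d → Fin d → ℝ}
    (hc : IsStochastic c) (f : ℕ → ℝ) (a : State N d) :
    ∑ b : State N d, rate N d mu mu c a b * (f b.1.val - f a.1.val) = gen N mu f a.1.val := by
  obtain ⟨k, j⟩ := a
  rw [Fintype.sum_prod_type]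
  by_cases hk : k.val = 0
  · simp only [rate, hk, gen, if_true]
    rw [Finset.sum_eq_single (⟨1, by omega⟩ : Fin (N + 1))]
    · simp only [if_true, ← Finset.sum_mul, hc.2, one_mul]
    · intro b _ hb
      have : b.val ≠ 1 := fun h => hb (Fin.ext h)
      simp [this]
    · simp
  · have h1 : ∀ b : Fin (N + 1), ∑ i : Fin d, rate N d mu mu c (k, j) (b, i) * (f b - f k)
        = (if b.val + 1 = k.val then mu * (N + k.val) * (f (k.val - 1) - f k) else 0)
          + (if b.val = k.val + 1 then mu * (N - k.val) * (f (k.val + 1) - f k) else 0) := by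
      intro b
      rw [Finset.sum_eq_single j]
      · simp only [rate, hk, if_false, if_true]
        by_cases h : b.val + 1 = k.val
        · have h' : ¬ (b.val = k.val + 1) := by omega
          rw [if_pos h, if_pos h, if_neg h', add_zero, ← h, Nat.add_sub_cancel]
        · rw [if_neg h, if_neg h, zero_add]
          by_cases h' : b.val = k.val + 1
          · rw [if_pos h', if_pos h', h']
          · rw [if_neg h', if_neg h', zero_mul]
      · intro i _ hi
        simp [rate, hk, hi]
      · simp
    simp only [h1, Finset.sum_add_distrib, gen, hk, if_false]
    congr 1
    · rw [Finset.sum_eq_single (⟨k.val - 1, by omega⟩ : Fin (N + 1))]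
      · rw [if_pos (by simp only; omega)]
      · intro b _ hb
        rw [if_neg]
        intro h
        exact hb (Fin.ext (by simp only; omega))
      · simp
    -- At the top level there is no state above, but the factor `N - k` vanishes too.
    · by_cases hkN : k.val = N
      · simp [hkN]
      · rw [Finset.sum_eq_single (⟨k.val + 1, by omega⟩ : Fin (N + 1))]
        · rw [if_pos rfl]
        · intro b _ hb
          rw [if_neg]
          intro h
          exact hb (Fin.ext h)
        · simp

/-- `p b x` is the probability that the chain on `{0, …, N}` with generator `gen N mu`, started
at `0`, is at `b` at time `x`: this is expressed through expectations of functions. -/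
structure IsOccupation (N : ℕ) (mu : ℝ) (p : ℕ → ℝ → ℝ) : Prop where
  continuous : ∀ f : ℕ → ℝ, Continuous fun x => ∑ b ∈ Finset.range (N + 1), p b x * f b
  deriv : ∀ (f : ℕ → ℝ) (x : ℝ), 0 ≤ x →
    HasDerivWithinAt (fun x => ∑ b ∈ Finset.range (N + 1), p b x * f b)
      (∑ b ∈ Finset.range (N + 1), p b x * gen N mu f b) (Set.Ici x) x
  zero : ∀ f : ℕ → ℝ, ∑ b ∈ Finset.range (N + 1), p b 0 * f b = f 0

theorem cond_real_eq_sum {Ω S : Type*} [MeasurableSpace Ω] [Fintype S] [DecidableEq S]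
    [MeasurableSpace S] [MeasurableSingletonClass S] {ℙ : Measure Ω} [IsProbabilityMeasure ℙ]
    {X : ℝ≥0 → Ω → S} (hX : ∀ t, Measurable (X t)) {P : ℝ≥0 → Matrix S S ℝ}
    (hM : ∀ (s h : ℝ≥0) (A : Set Ω), MeasurableSet[past X s] A → ∀ a b : S,
      ℙ.real (A ∩ {ω | X s ω = a} ∩ {ω | X (s + h) ω = b})
        = ℙ.real (A ∩ {ω | X s ω = a}) * P h a b)
    (a : S) (ha : ℙ {ω | X 0 ω = a} ≠ 0) (t : ℝ≥0) (s : Finset S) :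
    (ProbabilityTheory.cond ℙ {ω | X 0 ω = a}).real {ω | X t ω ∈ s} = ∑ b ∈ s, P t a b := by
  have hmeas : ∀ t b, MeasurableSet {ω | X t ω = b} := fun t b =>
    hX t (measurableSet_singleton b)
  have hreal : ℙ.real {ω | X 0 ω = a} ≠ 0 := by
    rw [Measure.real, ENNReal.toReal_ne_zero]
    exact ⟨ha, measure_ne_top _ _⟩
  have h1 : ∀ b, ℙ.real ({ω | X 0 ω = a} ∩ {ω | X t ω = b})
      = ℙ.real {ω | X 0 ω = a} * P t a b := by
    intro b
    have := hM 0 t Set.univ MeasurableSet.univ a b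
    simpa using this
  have h2 : ({ω | X 0 ω = a} ∩ {ω | X t ω ∈ s})
      = ⋃ b ∈ s, ({ω | X 0 ω = a} ∩ {ω | X t ω = b}) := by
    ext ω
    simp
  rw [measureReal_def, ProbabilityTheory.cond_apply (hmeas 0 a), ENNReal.toReal_mul,
    ENNReal.toReal_inv, ← measureReal_def, ← measureReal_def, h2, measureReal_biUnion_finset]
  · simp only [h1, ← Finset.mul_sum]
    rw [← mul_assoc, inv_mul_cancel₀ hreal, one_mul]
  · intro b _ b' _ hbb'
    rw [Function.onFun, Set.disjoint_left]
    rintro ω ⟨-, h⟩ ⟨-, h'⟩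
    exact hbb' (h.symm.trans h')
  · intro b _
    exact (hmeas 0 a).inter (hmeas t b)

theorem exists_isOccupation {N d : ℕ} (hN : 1 ≤ N) {mu : ℝ} {c : Fin d → Fin d → ℝ}
    (hc : IsStochastic c) {Ω : Type*} [MeasurableSpace Ω] {ℙ : Measure Ω} [IsProbabilityMeasure ℙ]
    {X : ℝ≥0 → Ω → State N d} (hX : IsMarkovChainWithRates (rate N d mu mu c) ℙ X)
    (l₀ : Fin d) (hl₀ : ℙ {ω | X 0 ω = (0, l₀)} ≠ 0) :
    ∃ p : ℕ → ℝ → ℝ, IsOccupation N mu p ∧ ∀ (t : ℝ≥0) (r : ℕ), prob ℙ X l₀ r t = p r t := by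
  obtain ⟨hmeas, P, hP, hq, hM⟩ := hX
  set p : ℕ → ℝ → ℝ := fun b x =>
    ∑ y ∈ Finset.univ.filter (fun y : State N d => y.1.val = b), P x.toNNReal (0, l₀) y with hp
  have hsum : ∀ (f : ℕ → ℝ) (x : ℝ), ∑ b ∈ Finset.range (N + 1), p b x * f b
      = ∑ y : State N d, P x.toNNReal (0, l₀) y * f y.1.val := by
    intro f x
    rw [← Finset.sum_fiberwise_of_maps_to (s := Finset.univ) (t := Finset.range (N + 1))
      (g := fun y : State N d => y.1.val) (fun y _ => Finset.mem_range.2 y.1.isLt)]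
    refine Finset.sum_congr rfl fun b _ => ?_
    rw [hp, Finset.sum_mul]
    refine Finset.sum_congr rfl fun y hy => ?_
    rw [(Finset.mem_filter.1 hy).2]
  refine ⟨p, ⟨fun f => ?_, fun f x hx => ?_, fun f => ?_⟩, fun t r => ?_⟩
  · simp only [hsum]
    exact (hP.continuous_expect hq _ fun y : State N d => f y.1.val).comp continuous_real_toNNReal
  · simp only [hsum]
    refine (hP.hasDerivWithinAt_expect hq (0, l₀) (fun y : State N d => f y.1.val) x
      hx).congr_deriv (Finset.sum_congr rfl fun y _ => ?_)
    rw [sum_rate_mul hN hc f y]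
  · rw [hsum, Real.toNNReal_zero, hP.zero]
    simp [Matrix.one_apply]
  · have := cond_real_eq_sum hmeas hM (0, l₀) hl₀ t
      (Finset.univ.filter fun y : State N d => y.1.val = r)
    simp only [Finset.mem_filter, Finset.mem_univ, true_and] at this
    rw [prob, this]
    simp only [hp, Real.toNNReal_coe]

/-! ### Krawtchouk values -/

open Polynomial

/-- The generating polynomial of Krawtchouk values. -/
noncomputable def krawtchouk (i j : ℕ) : ℝ[X] := (1 + X) ^ i * (1 - X) ^ j

theorem krawtchouk_recurrence (i j : ℕ) :
    (i : ℝ[X]) * krawtchouk (i - 1) (j + 1) + (j : ℝ[X]) * krawtchouk (i + 1) (j - 1)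
      = ((i + j : ℕ) : ℝ[X]) * krawtchouk i j - 2 * (X * derivative (krawtchouk i j)) := by
  simp only [krawtchouk, derivative_mul, derivative_pow, derivative_add, derivative_sub,
    derivative_one, derivative_X, map_natCast]
  rcases i with _ | i <;> rcases j with _ | j <;> simp <;> ring

/-- The eigenvalue equation of the Ehrenfest walk with `i` and `j` balls in the two urns. The
truncated subtractions are harmless, being multiplied by zero. -/
theorem krawtchouk_coeff_recurrence (i j m : ℕ) :
    (i : ℝ) * (krawtchouk (i - 1) (j + 1)).coeff m + (j : ℝ) * (krawtchouk (i + 1) (j - 1)).coeff m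
      = (i + j - 2 * m) * (krawtchouk i j).coeff m := by
  have h := congrArg (fun p : ℝ[X] => p.coeff m) (krawtchouk_recurrence i j)
  have hd : (X * derivative (krawtchouk i j)).coeff m = m * (krawtchouk i j).coeff m := by
    rcases m with _ | m
    · simp
    · rw [coeff_X_mul, coeff_derivative]
      push_cast
      ring
  simp only [coeff_add, coeff_sub, ← C_eq_natCast, coeff_C_mul, coeff_ofNat_mul, hd] at h
  rw [h]
  push_cast
  ring

/-- Substituting `-X` for `X` exchanges the two factors. -/
theorem krawtchouk_coeff_swap (i j m : ℕ) :
    (krawtchouk j i).coeff m = (-1) ^ m * (krawtchouk i j).coeff m := by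
  have : krawtchouk j i = (krawtchouk i j).comp (C (-1) * X) := by
    simp only [krawtchouk, mul_comp, pow_comp, add_comp, sub_comp, one_comp, X_comp, C_neg, C_1]
    ring
  rw [this, comp_C_mul_X_coeff, mul_comm]

theorem krawtchouk_zero_coeff_ne_zero {n m : ℕ} (h : m ≤ n) :
    (krawtchouk 0 n).coeff m ≠ 0 := by
  rw [krawtchouk_coeff_swap n 0]
  simp only [krawtchouk, pow_zero, mul_one, coeff_one_add_X_pow]
  exact mul_ne_zero (by simp) (by exact_mod_cast (Nat.choose_pos h).ne')

theorem krawtchouk_self_coeff_odd (n m : ℕ) (hm : Odd m) : (krawtchouk n n).coeff m = 0 := by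
  have := krawtchouk_coeff_swap n n m
  rw [hm.neg_one_pow] at this
  linarith

theorem eq_of_coeff_of_eval {p q : ℝ[X]} {n : ℕ} (hp : p.natDegree ≤ n) (hq : q.natDegree ≤ n)
    (hc : p.coeff n = q.coeff n) (v : Fin n → ℝ) (hv : Function.Injective v)
    (h : ∀ k, p.eval (v k) = q.eval (v k)) : p = q := by
  rw [← sub_eq_zero]
  rcases eq_or_ne (p - q) 0 with h0 | h0
  · exact h0
  refine eq_zero_of_natDegree_lt_card_of_eval_eq_zero (p - q) hv (fun k => by simp [h]) ?_
  rw [Fintype.card_fin]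
  refine lt_of_le_of_ne ((natDegree_sub_le _ _).trans (max_le hp hq)) fun hd => h0 ?_
  rw [← leadingCoeff_eq_zero, leadingCoeff, hd, coeff_sub, hc, sub_self]

/-! ### Eigenfunctions and their factorisation at level zero -/

/-- Up to normalisation, the solution of the eigenvalue equation of `gen N mu` at `N, N - 1, …`:
the polynomial with index `i` is the value at `N - i`, as a function of the eigenvalue. -/
noncomputable def decayPoly (N : ℕ) (mu : ℝ) : ℕ → ℝ[X]
  | 0 => 1
  | 1 => C (mu * (2 * N))⁻¹ * (X + C (2 * N * mu))
  | i + 2 => C (mu * (2 * N - (i + 1)))⁻¹ *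
      ((X + C (2 * N * mu)) * decayPoly N mu (i + 1) - C (mu * (i + 1)) * decayPoly N mu i)

variable {N : ℕ} {mu : ℝ}

/-- With `i = N - b`, the rates down and up are `μ(2N - i)` and `μi`. Indices beyond `N` belong to
negative levels of the full walk. -/
theorem decayPoly_recurrence (hmu : 0 < mu) {i : ℕ} (hi : i < 2 * N) :
    C (mu * (2 * N - i)) * decayPoly N mu (i + 1)
      = (X + C (2 * N * mu)) * decayPoly N mu i - C (mu * i) * decayPoly N mu (i - 1) := by
  have h : mu * (2 * N - i) ≠ 0 := by
    have : (i : ℝ) < 2 * N := by exact_mod_cast hi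
    exact mul_ne_zero hmu.ne' (by linarith)
  rcases i with _ | i
  · simp only [decayPoly, Nat.cast_zero, sub_zero] at h ⊢
    rw [← mul_assoc, ← C_mul, mul_inv_cancel₀ h]
    simp
  · rw [decayPoly, ← mul_assoc, ← C_mul]
    push_cast at h ⊢
    rw [mul_inv_cancel₀ h]
    simp

theorem decayPoly_natDegree_le (N : ℕ) (mu : ℝ) :
    ∀ i, (decayPoly N mu i).natDegree ≤ i
  | 0 => by simp [decayPoly]
  | 1 => by
    rw [decayPoly]
    exact (natDegree_C_mul_le _ _).trans (natDegree_X_add_C _).le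
  | i + 2 => by
    rw [decayPoly]
    refine (natDegree_C_mul_le _ _).trans ((natDegree_sub_le _ _).trans (max_le ?_ ?_))
    · refine natDegree_mul_le.trans ?_
      rw [natDegree_X_add_C]
      have := decayPoly_natDegree_le N mu (i + 1)
      omega
    · refine (natDegree_C_mul_le _ _).trans ?_
      have := decayPoly_natDegree_le N mu i
      omega

theorem decayPoly_coeff_ne_zero (hmu : 0 < mu) :
    ∀ i, i ≤ 2 * N → (decayPoly N mu i).coeff i ≠ 0
  | 0, _ => by simp [decayPoly]
  | i + 1, hi => by
    have h := congrArg (fun p : ℝ[X] => p.coeff (i + 1)) (decayPoly_recurrence hmu (i := i) hi)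
    have h1 : (decayPoly N mu i).coeff (i + 1) = 0 :=
      coeff_eq_zero_of_natDegree_lt (Nat.lt_succ_of_le (decayPoly_natDegree_le N mu i))
    have h2 : (decayPoly N mu (i - 1)).coeff (i + 1) = 0 :=
      coeff_eq_zero_of_natDegree_lt (by have := decayPoly_natDegree_le N mu (i - 1); omega)
    simp only [coeff_C_mul, coeff_sub, add_mul, coeff_add, coeff_X_mul, h1, h2, mul_zero,
      add_zero, sub_zero] at h
    intro h0
    rw [h0, mul_zero] at h
    exact decayPoly_coeff_ne_zero hmu i (by omega) h.symm

/-- At the eigenvalue `-2μm` both sides obey the same recurrence in `i` and agree at `i = 0`. -/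
theorem decayPoly_eval_mul (hmu : 0 < mu) (m : ℕ) :
    ∀ i, i ≤ 2 * N → (decayPoly N mu i).eval (-(2 * mu * m)) * (krawtchouk 0 (2 * N)).coeff m
      = (krawtchouk i (2 * N - i)).coeff m := by
  intro i
  induction i using Nat.strong_induction_on with
  | _ i ih =>
    intro hi
    rcases i with _ | i
    · simp [decayPoly]
    · have h := congrArg (fun p : ℝ[X] => p.eval (-(2 * mu * m)))
        (decayPoly_recurrence hmu (i := i) hi)
      simp only [eval_mul, eval_C, eval_sub, eval_add, eval_X] at h
      have hk := krawtchouk_coeff_recurrence i (2 * N - i) m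
      have hi' : (i : ℝ) < 2 * N := by exact_mod_cast hi
      have hne : mu * (2 * N - i) ≠ 0 := mul_ne_zero hmu.ne' (by linarith)
      have h1 := ih i (by omega) (by omega)
      rw [show 2 * N - i - 1 = 2 * N - (i + 1) by omega,
        Nat.cast_sub (by omega : i ≤ 2 * N)] at hk
      push_cast at hk
      apply mul_left_cancel₀ hne
      rw [← mul_assoc, h]
      rcases Nat.eq_zero_or_pos i with rfl | hpos
      · simp only [Nat.cast_zero, zero_mul, mul_zero, zero_add, sub_zero] at hk h1 ⊢
        linear_combination (-(2 * mu * m) + 2 * N * mu) * h1 - mu * hk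
      · have h2 := ih (i - 1) (by omega) (by omega)
        rw [show 2 * N - (i - 1) = 2 * N - i + 1 by omega] at h2
        linear_combination (-(2 * mu * m) + 2 * N * mu) * h1 - mu * i * h2 - mu * hk

theorem monic_prod_X_add_C (n : ℕ) (f : ℕ → ℝ) :
    (∏ r ∈ Finset.range n, (X + C (f r))).Monic :=
  monic_prod_of_monic _ _ fun r _ => monic_X_add_C (f r)

theorem natDegree_prod_X_add_C (n : ℕ) (f : ℕ → ℝ) :
    (∏ r ∈ Finset.range n, (X + C (f r))).natDegree = n := by
  rw [natDegree_prod_of_monic _ _ fun r _ => monic_X_add_C (f r)]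
  simp

theorem coeff_prod_X_add_C (n : ℕ) (f : ℕ → ℝ) :
    (∏ r ∈ Finset.range n, (X + C (f r))).coeff n = 1 := by
  have := monic_prod_X_add_C n f
  rwa [Monic, leadingCoeff, natDegree_prod_X_add_C] at this

/-- `∏ (X + 2μ(2r+1))` -/
noncomputable def oddProd (N : ℕ) (mu : ℝ) : ℝ[X] :=
  ∏ r ∈ Finset.range N, (X + C (2 * mu * (2 * (r : ℝ) + 1)))

/-- `∏ (X + 2μ(2r+2))` -/
noncomputable def evenProd (N : ℕ) (mu : ℝ) : ℝ[X] :=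
  ∏ r ∈ Finset.range N, (X + C (2 * mu * (2 * (r : ℝ) + 2)))

theorem oddProd_eval (x : ℝ) : (oddProd N mu).eval x = polyQ N mu x := by
  simp [oddProd, polyQ, eval_prod]

/-- The polynomial `(1 - X²)^N` has no odd coefficients, so the value at level `0` vanishes at the
`N` points `-2μ(2k + 1)`, as many as its degree. -/
theorem decayPoly_eq_oddProd (hmu : 0 < mu) :
    decayPoly N mu N = C ((decayPoly N mu N).coeff N) * oddProd N mu := by
  refine eq_of_coeff_of_eval (n := N) (decayPoly_natDegree_le N mu N)
    ((natDegree_C_mul_le _ _).trans (natDegree_prod_X_add_C _ _).le) ?_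
    (fun k => -(2 * mu * ((2 * k.val + 1 : ℕ) : ℝ))) ?_ ?_
  · rw [coeff_C_mul, oddProd, coeff_prod_X_add_C, mul_one]
  · intro k l h
    simp only [neg_inj, mul_eq_mul_left_iff, Nat.cast_inj] at h
    have : mu ≠ 0 := hmu.ne'
    have h2 : 2 * k.val + 1 = 2 * l.val + 1 := by simpa [this] using h
    exact Fin.ext (by omega)
  · intro k
    have h := decayPoly_eval_mul (N := N) hmu (2 * k.val + 1) N (by omega)
    rw [show 2 * N - N = N by omega, krawtchouk_self_coeff_odd _ _ ⟨k.val, rfl⟩] at h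
    rw [(mul_eq_zero.1 h).resolve_right (krawtchouk_zero_coeff_ne_zero (by omega)), eval_mul,
      oddProd, eval_prod, Finset.prod_eq_zero (Finset.mem_range.2 k.isLt), mul_zero]
    simp

/-- The left side is the defect in the eigenvalue equation at `0` for the walk reflected
symmetrically, with rate `2μN` to level `1`. Krawtchouk values of even index are even in the level,
so it vanishes at the `N + 1` points `-2μ(2k)`. -/
theorem decayPoly_eq_evenProd (hmu : 0 < mu) (hN : 1 ≤ N) :
    X * decayPoly N mu N - C (2 * mu * N) * (decayPoly N mu (N - 1) - decayPoly N mu N)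
      = C ((decayPoly N mu N).coeff N) * (X * evenProd N mu) := by
  have hd := decayPoly_natDegree_le N mu N
  have hd' := decayPoly_natDegree_le N mu (N - 1)
  have hsub : (decayPoly N mu (N - 1) - decayPoly N mu N).natDegree ≤ N :=
    (natDegree_sub_le _ _).trans (max_le (by omega) hd)
  refine eq_of_coeff_of_eval (n := N + 1) ?_ ?_ ?_
    (fun k => -(2 * mu * ((2 * k.val : ℕ) : ℝ))) ?_ ?_
  · refine (natDegree_sub_le _ _).trans (max_le ?_ ?_)
    · refine natDegree_mul_le.trans ?_
      rw [natDegree_X]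
      omega
    · exact (natDegree_C_mul_le _ _).trans (by omega)
  · refine (natDegree_C_mul_le _ _).trans (natDegree_mul_le.trans ?_)
    rw [natDegree_X, evenProd, natDegree_prod_X_add_C, add_comm]
  · rw [coeff_sub, coeff_X_mul, coeff_C_mul, coeff_C_mul, coeff_X_mul, evenProd,
      coeff_prod_X_add_C, coeff_eq_zero_of_natDegree_lt (Nat.lt_succ_of_le hsub)]
    ring
  · intro k l h
    simp only [neg_inj, mul_eq_mul_left_iff, Nat.cast_inj] at h
    have : mu ≠ 0 := hmu.ne'
    have h2 : 2 * k.val = 2 * l.val := by simpa [this] using h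
    exact Fin.ext (by omega)
  · intro k
    have h0 := decayPoly_eval_mul (N := N) hmu (2 * k.val) N (by omega)
    have h1 := decayPoly_eval_mul (N := N) hmu (2 * k.val) (N - 1) (by omega)
    rw [show 2 * N - N = N by omega] at h0
    rw [show 2 * N - (N - 1) = N + 1 by omega] at h1
    have hk := krawtchouk_coeff_recurrence N N (2 * k.val)
    rw [krawtchouk_coeff_swap (N - 1) (N + 1), (even_two_mul k.val).neg_one_pow, one_mul] at hk
    have hne : (krawtchouk 0 (2 * N)).coeff (2 * k.val) ≠ 0 :=
      krawtchouk_zero_coeff_ne_zero (by omega)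
    have hr : (C ((decayPoly N mu N).coeff N) * (X * evenProd N mu)).eval
        (-(2 * mu * ((2 * k.val : ℕ) : ℝ))) = 0 := by
      rw [eval_mul, eval_mul, eval_X]
      rcases Nat.eq_zero_or_pos k.val with hk0 | hk0
      · simp [hk0]
      · rw [evenProd, eval_prod, Finset.prod_eq_zero (i := k.val - 1)
          (Finset.mem_range.2 (by omega)), mul_zero, mul_zero]
        rw [Nat.cast_sub hk0]
        simp
        ring
    rw [hr]
    apply mul_right_cancel₀ hne
    simp only [eval_sub, eval_mul, eval_X, eval_C, zero_mul]
    linear_combination (-(2 * mu * ((2 * k.val : ℕ) : ℝ)) + 2 * mu * N) * h0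
      - 2 * mu * N * h1 - mu * hk

/-- The polynomial function `polyP` as a polynomial. -/
noncomputable def charPoly (N : ℕ) (mu : ℝ) : ℝ[X] := X * (oddProd N mu + evenProd N mu)

theorem charPoly_eval (x : ℝ) : (charPoly N mu).eval x = polyP N mu x := by
  simp [charPoly, oddProd, evenProd, polyP, eval_prod]

theorem charPoly_natDegree_le : (charPoly N mu).natDegree ≤ N + 1 := by
  refine natDegree_mul_le.trans ?_
  have h := natDegree_add_le (oddProd N mu) (evenProd N mu)
  rw [oddProd, evenProd, natDegree_prod_X_add_C, natDegree_prod_X_add_C, max_self] at h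
  rw [natDegree_X, oddProd, evenProd]
  omega

theorem charPoly_coeff : (charPoly N mu).coeff (N + 1) = 2 := by
  rw [charPoly, coeff_X_mul, coeff_add, oddProd, evenProd, coeff_prod_X_add_C, coeff_prod_X_add_C]
  norm_num

/-- At a root of `polyP`, the polynomials `decayPoly` give an eigenfunction of `gen`. -/
theorem gen_decayPoly (hmu : 0 < mu) (hN : 1 ≤ N) {x : ℝ} (hx : polyP N mu x = 0) {b : ℕ}
    (hb : b ≤ N) : gen N mu (fun b => (decayPoly N mu (N - b)).eval x) b
      = x * (decayPoly N mu (N - b)).eval x := by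
  rcases Nat.eq_zero_or_pos b with rfl | hb0
  · have h1 := congrArg (fun p : ℝ[X] => p.eval x) (decayPoly_eq_oddProd (N := N) hmu)
    have h2 := congrArg (fun p : ℝ[X] => p.eval x) (decayPoly_eq_evenProd (N := N) hmu hN)
    rw [← charPoly_eval, charPoly] at hx
    simp only [eval_sub, eval_add, eval_mul, eval_X, eval_C] at h1 h2 hx
    simp only [gen, if_true, Nat.sub_zero]
    -- The true rate out of `0` is half the reflected one, so the condition at `0` is half the sum
    -- of the two factorised expressions: a multiple of `polyP`.
    linear_combination (-(1:ℝ) / 2) * h2 - x / 2 * h1 - (decayPoly N mu N).coeff N / 2 * hx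
  · have h := congrArg (fun p : ℝ[X] => p.eval x)
      (decayPoly_recurrence (N := N) (i := N - b) hmu (by omega))
    simp only [eval_sub, eval_add, eval_mul, eval_X, eval_C] at h
    rw [Nat.cast_sub hb] at h
    rw [gen, if_neg (by omega), show N - (b - 1) = N - b + 1 by omega, ← Nat.sub_sub]
    linear_combination h

/-! ### Location of the roots of `polyP` -/

theorem exists_polyP_root_between (hmu : 0 < mu) {r : ℕ} (hr : r < N) :
    ∃ x, -(2 * mu * (2 * r + 2)) < x ∧ x < -(2 * mu * (2 * r + 1)) ∧ polyP N mu x = 0 := by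
  set S : ℝ → ℝ := fun x => (oddProd N mu + evenProd N mu).eval x with hS
  have hcont : Continuous S := (oddProd N mu + evenProd N mu).continuous
  have ha : S (-(2 * mu * (2 * r + 2))) = ∏ s ∈ Finset.range N, 2 * mu * (2 * (s - r) - 1) := by
    have h0 : (evenProd N mu).eval (-(2 * mu * (2 * r + 2))) = 0 := by
      rw [evenProd, eval_prod]
      exact Finset.prod_eq_zero (Finset.mem_range.2 hr) (by simp)
    simp only [hS, eval_add, h0, add_zero]
    rw [oddProd, eval_prod]
    refine Finset.prod_congr rfl fun s _ => ?_
    simp only [eval_add, eval_X, eval_C]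
    ring
  have hb : S (-(2 * mu * (2 * r + 1))) = ∏ s ∈ Finset.range N, 2 * mu * (2 * (s - r) + 1) := by
    have h0 : (oddProd N mu).eval (-(2 * mu * (2 * r + 1))) = 0 := by
      rw [oddProd, eval_prod]
      exact Finset.prod_eq_zero (Finset.mem_range.2 hr) (by simp)
    simp only [hS, eval_add, h0, zero_add]
    rw [evenProd, eval_prod]
    refine Finset.prod_congr rfl fun s _ => ?_
    simp only [eval_add, eval_X, eval_C]
    ring
  -- At each endpoint only one product survives. Paired factors give `4μ²(4(s - r)² - 1)`, which is
  -- negative only for `s = r`.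
  have hneg : S (-(2 * mu * (2 * r + 2))) * S (-(2 * mu * (2 * r + 1))) < 0 := by
    rw [ha, hb, ← Finset.prod_mul_distrib, ← Finset.mul_prod_erase _ _ (Finset.mem_range.2 hr)]
    refine mul_neg_of_neg_of_pos ?_ (Finset.prod_pos fun s hs => ?_)
    · rw [sub_self]
      nlinarith
    · have hsr : s ≠ r := Finset.ne_of_mem_erase hs
      have h1 : (1 : ℝ) ≤ ((s : ℝ) - r) ^ 2 := by
        have : (1 : ℤ) ≤ ((s : ℤ) - r) ^ 2 := by
          have h0 : (s : ℤ) - r ≠ 0 := by omega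
          have := sq_pos_of_ne_zero (R := ℤ) h0
          omega
        exact_mod_cast this
      have : 2 * mu * (2 * ((s : ℝ) - r) - 1) * (2 * mu * (2 * (s - r) + 1))
          = 4 * mu ^ 2 * (4 * ((s : ℝ) - r) ^ 2 - 1) := by ring
      rw [this]
      have : (0 : ℝ) < 4 * ((s : ℝ) - r) ^ 2 - 1 := by linarith
      positivity
  have hle : -(2 * mu * (2 * r + 2)) ≤ -(2 * mu * (2 * (r : ℝ) + 1)) := by linarith
  have hroot : ∃ x ∈ Set.Ioo (-(2 * mu * (2 * r + 2))) (-(2 * mu * (2 * (r : ℝ) + 1))),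
      S x = 0 := by
    rcases mul_neg_iff.1 hneg with ⟨h1, h2⟩ | ⟨h1, h2⟩
    · exact intermediate_value_Ioo' hle hcont.continuousOn ⟨h2, h1⟩
    · exact intermediate_value_Ioo hle hcont.continuousOn ⟨h1, h2⟩
  obtain ⟨x, hx, h0⟩ := hroot
  refine ⟨x, hx.1, hx.2, ?_⟩
  rw [← charPoly_eval, charPoly, eval_mul]
  exact mul_eq_zero_of_right _ h0

/-- One root per disjoint interval, besides `0`. The intervals are kept because they also separate
the roots from the multiples of `2μ` in the denominators. -/
theorem exists_polyP_roots (hmu : 0 < mu) :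
    ∃ α : Fin (N + 1) → ℝ, StrictAnti α ∧ α 0 = 0 ∧ (∀ k, polyP N mu (α k) = 0) ∧
      ∀ k : Fin N, -(2 * mu * (2 * (k.val : ℝ) + 2)) < α k.succ ∧
        α k.succ < -(2 * mu * (2 * (k.val : ℝ) + 1)) := by
  have h : ∀ k : Fin N, ∃ x, -(2 * mu * (2 * (k.val : ℝ) + 2)) < x ∧
      x < -(2 * mu * (2 * (k.val : ℝ) + 1)) ∧ polyP N mu x = 0 := fun k =>
    exists_polyP_root_between hmu k.isLt
  choose x hx1 hx2 hx3 using h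
  refine ⟨Fin.cons 0 x, ?_, rfl, ?_, fun k => ⟨by simpa using hx1 k, by simpa using hx2 k⟩⟩
  · rw [Fin.strictAnti_iff_succ_lt]
    intro i
    rw [Fin.cons_succ]
    have h2 := hx2 i
    rcases Nat.eq_zero_or_pos i.val with h0 | hpos
    · have : i.castSucc = 0 := Fin.ext h0
      rw [this, Fin.cons_zero]
      have : (0 : ℝ) ≤ i.val := Nat.cast_nonneg _
      nlinarith
    · obtain ⟨j, hj⟩ : ∃ j : Fin N, i.castSucc = j.succ :=
        ⟨⟨i.val - 1, by omega⟩, Fin.ext (by simp; omega)⟩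
      rw [hj, Fin.cons_succ]
      have hij : i.val = j.val + 1 := by simpa using congrArg Fin.val hj
      have h1 := hx1 j
      rw [hij] at h2
      push_cast at h2
      nlinarith
  · intro k
    induction k using Fin.cases with
    | zero => simp [polyP]
    | succ k => simpa using hx3 k

theorem charPoly_eq_prod {α : Fin (N + 1) → ℝ} (hα : Function.Injective α)
    (hroot : ∀ k, polyP N mu (α k) = 0) :
    charPoly N mu = C 2 * ∏ k, (X - C (α k)) := by
  have hm : (∏ k, (X - C (α k))).Monic := monic_prod_of_monic _ _ fun k _ => monic_X_sub_C _
  have hdeg : (∏ k, (X - C (α k))).natDegree = N + 1 := by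
    rw [natDegree_prod_of_monic _ _ fun k _ => monic_X_sub_C _]
    simp
  refine eq_of_coeff_of_eval charPoly_natDegree_le
    ((natDegree_C_mul_le _ _).trans hdeg.le) ?_ α hα fun k => ?_
  · rw [charPoly_coeff, coeff_C_mul]
    rw [Monic, leadingCoeff, hdeg] at hm
    rw [hm, mul_one]
  · rw [charPoly_eval, hroot, eval_mul, eval_prod,
      Finset.prod_eq_zero (Finset.mem_univ k) (by simp), mul_zero]

theorem polyP_eq_prod {α : Fin (N + 1) → ℝ} (hα : Function.Injective α)
    (hroot : ∀ k, polyP N mu (α k) = 0) (x : ℝ) :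
    polyP N mu x = 2 * ∏ k, (x - α k) := by
  rw [← charPoly_eval, charPoly_eq_prod hα hroot]
  simp [eval_prod]

theorem polyP_eq_zero_iff {α : Fin (N + 1) → ℝ} (hα : Function.Injective α)
    (hroot : ∀ k, polyP N mu (α k) = 0) (x : ℝ) : polyP N mu x = 0 ↔ ∃ k, α k = x := by
  rw [polyP_eq_prod hα hroot, mul_eq_zero, or_iff_right two_ne_zero, Finset.prod_eq_zero_iff]
  simp only [Finset.mem_univ, true_and, sub_eq_zero, eq_comm]

theorem tendsto_polyP_div {α : Fin (N + 1) → ℝ} (hα : Function.Injective α)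
    (hroot : ∀ k, polyP N mu (α k) = 0) (k : Fin (N + 1)) :
    Tendsto (fun η : ℝ => polyP N mu η / (η - α k)) (𝓝[≠] (α k))
      (𝓝 (2 * ∏ s ∈ Finset.univ.erase k, (α k - α s))) := by
  have hc : Continuous fun η : ℝ => 2 * ∏ s ∈ Finset.univ.erase k, (η - α s) := by fun_prop
  refine ((hc.tendsto (α k)).mono_left nhdsWithin_le_nhds).congr' ?_
  filter_upwards [self_mem_nhdsWithin] with η hη
  have : η - α k ≠ 0 := sub_ne_zero.2 hη
  rw [polyP_eq_prod hα hroot, ← Finset.mul_prod_erase _ _ (Finset.mem_univ k)]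
  field_simp

/-! ### The probability of emptiness -/

/-- The probability of the empty state. -/
theorem IsOccupation.empty {p : ℕ → ℝ → ℝ} (hp : IsOccupation N mu p) (hmu : 0 < mu)
    (hN : 1 ≤ N) {α : Fin (N + 1) → ℝ} (hα : Function.Injective α)
    (hroot : ∀ k, polyP N mu (α k) = 0) (t : ℝ) (ht : 0 ≤ t) :
    p 0 t = ∑ k, polyQ N mu (α k) / (∏ s ∈ Finset.univ.erase k, (α k - α s))
      * Real.exp (α k * t) := by
  have heig : ∀ k, ∑ b ∈ Finset.range (N + 1), p b t * (decayPoly N mu (N - b)).eval (α k)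
      = (decayPoly N mu N).eval (α k) * Real.exp (α k * t) := by
    intro k
    set g : ℕ → ℝ := fun b => (decayPoly N mu (N - b)).eval (α k) with hg
    refine eq_of_hasDerivWithinAt_linear (c := -α k) (φ := fun _ => 0) (hp.continuous g)
      (fun x hx => (hp.deriv g x hx).congr_deriv ?_) (fun x => ?_) ?_ t ht
      (w := fun x => g 0 * Real.exp (α k * x))
    · rw [neg_neg, add_zero, Finset.mul_sum]
      refine Finset.sum_congr rfl fun b hb => ?_
      rw [gen_decayPoly hmu hN (hroot k) (Nat.lt_succ_iff.1 (Finset.mem_range.1 hb)), hg]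
      ring
    · refine ((((hasDerivAt_id x).const_mul (α k)).exp).const_mul (g 0)).congr_deriv ?_
      simp only [id]
      ring
    · rw [hp.zero]
      simp
  -- The Lagrange sum over `N + 1` nodes extracts the coefficient of degree `N`, while the
  -- polynomial at level `b` has degree at most `N - b`; only `b = 0` survives.
  have hlag : ∀ b ∈ Finset.range (N + 1),
      ∑ k, (decayPoly N mu (N - b)).eval (α k) / ∏ s ∈ Finset.univ.erase k, (α k - α s)
        = if b = 0 then (decayPoly N mu N).coeff N else 0 := by
    intro b hb
    have hdeg := decayPoly_natDegree_le N mu (N - b)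
    rw [← Lagrange.coeff_eq_sum hα.injOn]
    · rw [Finset.card_univ, Fintype.card_fin, Nat.add_sub_cancel]
      split_ifs with h
      · rw [h, Nat.sub_zero]
      · exact coeff_eq_zero_of_natDegree_lt (by have := Finset.mem_range.1 hb; omega)
    · rw [Finset.card_univ, Fintype.card_fin]
      exact degree_le_natDegree.trans_lt (by exact_mod_cast (by omega))
  have hsum : p 0 t * (decayPoly N mu N).coeff N
      = ∑ k, ((decayPoly N mu N).eval (α k) * Real.exp (α k * t))
        / ∏ s ∈ Finset.univ.erase k, (α k - α s) := by
    simp_rw [← heig, Finset.sum_div]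
    rw [Finset.sum_comm]
    simp_rw [mul_div_assoc, ← Finset.mul_sum]
    rw [Finset.sum_congr rfl fun b hb => by rw [hlag b hb]]
    simp
  have hne : (decayPoly N mu N).coeff N ≠ 0 := decayPoly_coeff_ne_zero hmu N (by omega)
  apply mul_right_cancel₀ hne
  rw [hsum, Finset.sum_mul]
  refine Finset.sum_congr rfl fun k _ => ?_
  have h1 := congrArg (fun p : ℝ[X] => p.eval (α k)) (decayPoly_eq_oddProd (N := N) hmu)
  simp only [eval_mul, eval_C, oddProd_eval] at h1
  rw [h1]
  ring

/-! ### Krawtchouk inversion and moments -/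

theorem krawtchouk_natDegree_le (i j : ℕ) : (krawtchouk i j).natDegree ≤ i + j := by
  refine natDegree_mul_le.trans (add_le_add ?_ ?_)
  · refine natDegree_pow_le.trans ?_
    have : (1 + X : ℝ[X]).natDegree ≤ 1 := by
      rw [add_comm, ← C_1]; exact (natDegree_X_add_C _).le
    nlinarith
  · refine natDegree_pow_le.trans ?_
    have : (1 - X : ℝ[X]).natDegree ≤ 1 :=
      (natDegree_sub_le _ _).trans (by simp)
    nlinarith

/-- The Krawtchouk transform is an involution up to a factor. -/
theorem sum_krawtchouk (i j : ℕ) :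
    ∑ m ∈ Finset.range (i + j + 1), C ((krawtchouk i j).coeff m) * krawtchouk (i + j - m) m
      = C (2 ^ (i + j)) * X ^ j := by
  -- The map `z ↦ (1 - z) / (1 + z)` turns `1 + X` and `1 - X` into `2 / (1 + z)` and `2z / (1 +
  -- z)`. Points `z > -1` avoid the pole and are infinitely many.
  refine eq_of_infinite_eval_eq _ _ ((Set.Ioi_infinite (-1 : ℝ)).mono fun z hz => ?_)
  have hz' : (1 + z) ≠ 0 := by
    have : -1 < z := hz
    linarith
  have h := eval_eq_sum_range' (Nat.lt_succ_of_le (krawtchouk_natDegree_le i j))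
    ((1 - z) / (1 + z))
  have h1 : (1 + z) ^ (i + j) * (krawtchouk i j).eval ((1 - z) / (1 + z))
      = 2 ^ (i + j) * z ^ j := by
    have e1 : 1 + (1 - z) / (1 + z) = 2 / (1 + z) := by field_simp; ring
    have e2 : 1 - (1 - z) / (1 + z) = 2 * z / (1 + z) := by field_simp; ring
    simp only [krawtchouk, eval_mul, eval_pow, eval_add, eval_sub, eval_one, eval_X]
    rw [e1, e2, div_pow, div_pow, pow_add, pow_add]
    field_simp
    ring
  rw [h, Finset.mul_sum] at h1
  simp only [Set.mem_ofPred_eq, eval_finsetSum, eval_mul, eval_C, eval_pow, eval_X]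
  rw [← h1]
  refine Finset.sum_congr rfl fun m hm => ?_
  have hm' : m ≤ i + j := Nat.lt_succ_iff.1 (Finset.mem_range.1 hm)
  obtain ⟨d, hd⟩ := Nat.exists_eq_add_of_le hm'
  rw [hd, Nat.add_sub_cancel_left]
  simp only [krawtchouk, eval_mul, eval_pow, eval_add, eval_sub, eval_one, eval_X]
  rw [div_pow, pow_add]
  field_simp

theorem sum_krawtchouk_coeff {b r : ℕ} (hb : b ≤ N) (hr : r ≤ N) :
    ∑ m ∈ Finset.range (2 * N + 1), (krawtchouk (N + b) (N - b)).coeff m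
      * (krawtchouk (2 * N - m) m).coeff (N - r) = if b = r then 4 ^ N else 0 := by
  have h := congrArg (fun p : ℝ[X] => p.coeff (N - r)) (sum_krawtchouk (N + b) (N - b))
  rw [show N + b + (N - b) = 2 * N by omega] at h
  simp only [finsetSum_coeff, coeff_C_mul, coeff_X_pow] at h
  rw [h, pow_mul]
  by_cases hbr : b = r
  · simp [hbr]; norm_num
  · rw [if_neg (by omega), if_neg hbr, mul_zero]

/-- The full walk has eigenvalue `-2μm`; the extra term at `0` compensates for the forbidden jump to
`-1`. -/
theorem gen_krawtchouk (m : ℕ) {b : ℕ} (hb : b ≤ N) :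
    gen N mu (fun b => (krawtchouk (N + b) (N - b)).coeff m) b
      = -(2 * mu * m) * (krawtchouk (N + b) (N - b)).coeff m
        + if b = 0 then mu * N * ((krawtchouk N N).coeff m
            - (krawtchouk (N - 1) (N + 1)).coeff m) else 0 := by
  have h := krawtchouk_coeff_recurrence (N + b) (N - b) m
  rcases Nat.eq_zero_or_pos b with rfl | hb0
  · simp only [gen, if_true, add_zero, Nat.sub_zero] at h ⊢
    linear_combination mu * h
  · rw [gen, if_neg (by omega), if_neg (by omega), ← Nat.add_sub_assoc hb0,
      show N - (b - 1) = N - b + 1 by omega, ← Nat.sub_sub, ← add_assoc]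
    push_cast [Nat.cast_sub hb] at h
    linear_combination mu * h

/-- The Krawtchouk moments of the occupation probabilities. -/
theorem IsOccupation.moment {p : ℕ → ℝ → ℝ} (hp : IsOccupation N mu p) {ι : Type*} [Fintype ι]
    (ρ α : ι → ℝ) (hempty : ∀ x, 0 ≤ x → p 0 x = ∑ k, ρ k * Real.exp (α k * x)) (m : ℕ)
    (hm : m = 0 ∨ ∀ k, α k + 2 * mu * m ≠ 0) (t : ℝ) (ht : 0 ≤ t) :
    ∑ b ∈ Finset.range (N + 1), p b t * (krawtchouk (N + b) (N - b)).coeff m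
      = Real.exp (-(2 * mu * m * t)) * (krawtchouk N N).coeff m
        + mu * N * ((krawtchouk N N).coeff m - (krawtchouk (N - 1) (N + 1)).coeff m)
          * ∑ k, ρ k * (Real.exp (α k * t) - Real.exp (-(2 * mu * m * t)))
            / (α k + 2 * mu * m) := by
  set f : ℕ → ℝ := fun b => (krawtchouk (N + b) (N - b)).coeff m with hf
  set δ : ℝ := mu * N * ((krawtchouk N N).coeff m - (krawtchouk (N - 1) (N + 1)).coeff m) with hδ
  set c : ℝ := 2 * mu * m with hc
  have hexp : ∀ a x : ℝ, HasDerivAt (fun x => Real.exp (a * x)) (a * Real.exp (a * x)) x := by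
    intro a x
    refine (((hasDerivAt_id x).const_mul a).exp).congr_deriv ?_
    simp only [id]
    ring
  have hexp' : ∀ x : ℝ, HasDerivAt (fun x => Real.exp (-(c * x))) (-c * Real.exp (-(c * x))) x := by
    intro x
    simpa only [neg_mul] using hexp (-c) x
  refine eq_of_hasDerivWithinAt_linear (c := c)
    (φ := fun x => δ * ∑ k, ρ k * Real.exp (α k * x)) (hp.continuous f)
    (fun x hx => (hp.deriv f x hx).congr_deriv ?_) (fun x => ?_) ?_ t ht
    (w := fun x => Real.exp (-(c * x)) * (krawtchouk N N).coeff m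
        + δ * ∑ k, ρ k * (Real.exp (α k * x) - Real.exp (-(c * x))) / (α k + c))
  · rw [← hempty x hx]
    have h1 : ∀ b ∈ Finset.range (N + 1), p b x * gen N mu f b
        = -c * (p b x * f b) + if b = 0 then δ * p 0 x else 0 := by
      intro b hb
      rw [gen_krawtchouk m (Nat.lt_succ_iff.1 (Finset.mem_range.1 hb))]
      split_ifs with h
      · subst h
        simp only [hf, hδ, hc, add_zero, Nat.sub_zero]
        ring
      · ring
    rw [Finset.sum_congr rfl h1, Finset.sum_add_distrib, Finset.mul_sum]
    simp
  · refine (((hexp' x).mul_const _).add ((HasDerivAt.fun_sum fun k _ =>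
      ((((hexp (α k) x).sub (hexp' x)).const_mul (ρ k)).div_const (α k + c))).const_mul
        δ)).congr_deriv ?_
    have h2 : δ * ∑ k, ρ k * (α k * Real.exp (α k * x) - -c * Real.exp (-(c * x))) / (α k + c)
        = δ * ∑ k, ρ k * Real.exp (α k * x)
          - c * (δ * ∑ k, ρ k * (Real.exp (α k * x) - Real.exp (-(c * x))) / (α k + c)) := by
      -- For `m = 0` a denominator may vanish, but the Krawtchouk value is constant in the level, so
      -- the forcing factor `δ` is zero.
      rcases hm with hm | hm
      · have : δ = 0 := by
          rw [hδ, hm]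
          simp [krawtchouk, coeff_zero_eq_eval_zero]
        simp [this]
      · rw [mul_left_comm c, ← mul_sub]
        congr 1
        rw [Finset.mul_sum, ← Finset.sum_sub_distrib]
        refine Finset.sum_congr rfl fun k _ => ?_
        have := hm k
        field_simp
        ring
    rw [h2]
    ring
  · rw [hp.zero]
    simp [hf]

theorem eq_sum_krawtchouk (p : ℕ → ℝ → ℝ) (r : ℕ) (hr : r ≤ N) (t : ℝ) :
    p r t = 1 / 4 ^ N * ∑ m ∈ Finset.range (2 * N + 1), (krawtchouk (2 * N - m) m).coeff (N - r)
      * ∑ b ∈ Finset.range (N + 1), p b t * (krawtchouk (N + b) (N - b)).coeff m := by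
  simp_rw [Finset.mul_sum (s := Finset.range (N + 1))]
  rw [Finset.sum_comm]
  have h1 : ∀ b ∈ Finset.range (N + 1), ∑ m ∈ Finset.range (2 * N + 1),
      (krawtchouk (2 * N - m) m).coeff (N - r)
        * (p b t * (krawtchouk (N + b) (N - b)).coeff m) = if b = r then 4 ^ N * p r t else 0 := by
    intro b hb
    have h := sum_krawtchouk_coeff (Nat.lt_succ_iff.1 (Finset.mem_range.1 hb)) hr
    calc _ = p b t * ∑ m ∈ Finset.range (2 * N + 1), (krawtchouk (N + b) (N - b)).coeff m
          * (krawtchouk (2 * N - m) m).coeff (N - r) := by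
          rw [Finset.mul_sum]
          exact Finset.sum_congr rfl fun m _ => by ring
      _ = _ := by
          rw [h]
          split_ifs with hbr
          · rw [hbr, mul_comm]
          · rw [mul_zero]
  rw [Finset.sum_congr rfl h1, Finset.sum_ite_eq' , if_pos (Finset.mem_range.2 (by omega))]
  field_simp

/-! ### Sparse expansions of the initial value and the defect -/

theorem sum_coeff_mul {ι : Type*} (s : Finset ι) (a : ι → ℝ) (e : ι → ℕ) (n : ℕ)
    (he : ∀ i ∈ s, e i < n) (g : ℕ → ℝ) :
    ∑ m ∈ Finset.range n, (∑ i ∈ s, C (a i) * X ^ e i : ℝ[X]).coeff m * g m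
      = ∑ i ∈ s, a i * g (e i) := by
  simp_rw [finsetSum_coeff, Finset.sum_mul, coeff_C_mul_X_pow]
  rw [Finset.sum_comm]
  refine Finset.sum_congr rfl fun i hi => ?_
  simp [ite_mul, he i hi]

theorem sum_krawtchouk_self_mul (N : ℕ) (g : ℕ → ℝ) :
    ∑ m ∈ Finset.range (2 * N + 1), (krawtchouk N N).coeff m * g m
      = ∑ l ∈ Finset.range (N + 1), (N.choose l : ℝ) * (-1) ^ l * g (2 * l) := by
  rw [← sum_coeff_mul (Finset.range (N + 1)) (fun l => (N.choose l : ℝ) * (-1) ^ l)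
    (fun l => 2 * l) (2 * N + 1) (fun l hl => by have := Finset.mem_range.1 hl; omega)]
  have : krawtchouk N N
      = ∑ l ∈ Finset.range (N + 1), C ((N.choose l : ℝ) * (-1) ^ l) * X ^ (2 * l) := by
    rw [krawtchouk, ← mul_pow, show ((1 + X) * (1 - X) : ℝ[X]) = -X ^ 2 + 1 by ring, add_pow]
    refine Finset.sum_congr rfl fun l _ => ?_
    rw [neg_pow, ← pow_mul]
    simp
    ring
  rw [this]

/-- The difference of generating polynomials is `(1 - X²)^(N - 1) * (2X - 2X²)`, whose two terms
produce the odd and even families of the closed form. -/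
theorem sum_krawtchouk_sub_mul (hN : 1 ≤ N) (g : ℕ → ℝ) :
    ∑ m ∈ Finset.range (2 * N + 1),
        ((krawtchouk N N).coeff m - (krawtchouk (N - 1) (N + 1)).coeff m) * g m
      = 2 * ∑ j ∈ Finset.range N, ((N - 1).choose j : ℝ) * (-1) ^ (N - 1 - j)
          * (g (2 * (N - 1 - j) + 1) - g (2 * (N - 1 - j) + 2)) := by
  set a : ℕ → ℝ := fun j => 2 * (((N - 1).choose j : ℝ) * (-1) ^ (N - 1 - j)) with ha
  have h : krawtchouk N N - krawtchouk (N - 1) (N + 1)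
      = ∑ j ∈ Finset.range N, C (a j) * X ^ (2 * (N - 1 - j) + 1)
        - ∑ j ∈ Finset.range N, C (a j) * X ^ (2 * (N - 1 - j) + 2) := by
    obtain ⟨n, rfl⟩ := Nat.exists_eq_add_of_le' hN
    simp only [Nat.add_sub_cancel] at ha ⊢
    have h1 : krawtchouk (n + 1) (n + 1) - krawtchouk n (n + 1 + 1)
        = (1 + -X ^ 2) ^ n * (2 * X - 2 * X ^ 2) := by
      rw [show (1 + -X ^ 2 : ℝ[X]) = (1 + X) * (1 - X) by ring, mul_pow]
      simp only [krawtchouk]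
      ring
    rw [h1, add_pow, ← Finset.sum_sub_distrib, Finset.sum_mul]
    refine Finset.sum_congr rfl fun j _ => ?_
    rw [neg_pow, ← pow_mul, ha]
    simp only [C_mul, C_pow, C_neg, C_1, C_eq_natCast, one_pow, C_ofNat]
    ring
  have hc : ∀ m, (krawtchouk N N).coeff m - (krawtchouk (N - 1) (N + 1)).coeff m
      = (∑ j ∈ Finset.range N, C (a j) * X ^ (2 * (N - 1 - j) + 1) : ℝ[X]).coeff m
        - (∑ j ∈ Finset.range N, C (a j) * X ^ (2 * (N - 1 - j) + 2) : ℝ[X]).coeff m := by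
    intro m
    rw [← coeff_sub, h, coeff_sub]
  simp_rw [hc, sub_mul, Finset.sum_sub_distrib]
  rw [sum_coeff_mul _ _ _ _ (fun j hj => by have := Finset.mem_range.1 hj; omega),
    sum_coeff_mul _ _ _ _ (fun j hj => by have := Finset.mem_range.1 hj; omega),
    ← Finset.sum_sub_distrib, Finset.mul_sum]
  refine Finset.sum_congr rfl fun j _ => ?_
  rw [ha]
  ring

/-! ### Hypergeometric form of Krawtchouk values -/

theorem choose_mul_descFactorial_div {n k i : ℕ} (hi : i ≤ n) :
    (n.choose k : ℝ) * (k.descFactorial i : ℝ) / (n.descFactorial i : ℝ)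
      = if i ≤ k then ((n - i).choose (k - i) : ℝ) else 0 := by
  have hne : (n.descFactorial i : ℝ) ≠ 0 := by
    exact_mod_cast (Nat.descFactorial_pos.2 hi).ne'
  split_ifs with hik
  · rw [div_eq_iff hne]
    have := Nat.choose_mul (n := n) hik
    rw [Nat.descFactorial_eq_factorial_mul_choose, Nat.descFactorial_eq_factorial_mul_choose]
    have h : (n.choose k : ℝ) * k.choose i = n.choose i * (n - i).choose (k - i) := by
      exact_mod_cast this
    push_cast
    linear_combination (i.factorial : ℝ) * h
  · rw [Nat.descFactorial_of_lt (not_le.1 hik)]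
    simp

/-- Expanding `1 - X = (1 + X) - 2X`; this is the source of the argument `2` of the series. -/
theorem krawtchouk_coeff_eq_sum {n a : ℕ} (ha : a ≤ n) (k : ℕ) :
    (krawtchouk (n - a) a).coeff k = ∑ i ∈ Finset.range (a + 1),
      (a.choose i : ℝ) * (-2) ^ i * if i ≤ k then ((n - i).choose (k - i) : ℝ) else 0 := by
  have : krawtchouk (n - a) a = ∑ i ∈ Finset.range (a + 1),
      C ((a.choose i : ℝ) * (-2) ^ i) * (X ^ i * (1 + X) ^ (n - i)) := by
    rw [krawtchouk, show (1 - X : ℝ[X]) = -2 * X + (1 + X) by ring,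
      add_pow (-2 * X), Finset.mul_sum]
    refine Finset.sum_congr rfl fun i hi => ?_
    have hi' : i ≤ a := Nat.lt_succ_iff.1 (Finset.mem_range.1 hi)
    rw [show n - i = (n - a) + (a - i) by omega, pow_add]
    have : (C ((a.choose i : ℝ) * (-2) ^ i) : ℝ[X]) = (a.choose i : ℝ[X]) * (-2) ^ i := by
      rw [C_mul, C_pow, C_neg, C_eq_natCast]
      rfl
    rw [this]
    ring
  rw [this, finsetSum_coeff]
  refine Finset.sum_congr rfl fun i _ => ?_
  rw [coeff_C_mul, coeff_X_pow_mul']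
  simp only [coeff_one_add_X_pow]

/-- Krawtchouk values as terminating Gauss hypergeometric series. -/
theorem choose_mul_ordinaryHypergeometric {n a : ℕ} (ha : a ≤ n) (k : ℕ) :
    (n.choose k : ℝ) * ordinaryHypergeometric (-(a : ℝ)) (-(k : ℝ)) (-(n : ℝ)) (2 : ℝ)
      = (krawtchouk (n - a) a).coeff k := by
  have hpoch : ∀ m i : ℕ, (ascPochhammer ℝ i).eval (-(m : ℝ))
      = (-1) ^ i * (m.descFactorial i : ℝ) := by
    intro m i
    rw [ascPochhammer_eval_neg_eq_descPochhammer, descPochhammer_eval_eq_descFactorial]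
  rw [krawtchouk_coeff_eq_sum ha, ordinaryHypergeometric_eq_tsum]
  beta_reduce
  -- Terms with `i > a` vanish with the Pochhammer factor of `-a`; since `a ≤ n`, the denominators
  -- of the remaining terms are nonzero.
  rw [tsum_eq_sum (s := Finset.range (a + 1)), Finset.mul_sum]
  · refine Finset.sum_congr rfl fun i hi => ?_
    have hi' : i ≤ a := Nat.lt_succ_iff.1 (Finset.mem_range.1 hi)
    rw [← choose_mul_descFactorial_div (hi'.trans ha), hpoch, hpoch, hpoch,
      Nat.descFactorial_eq_factorial_mul_choose a i, smul_eq_mul, mul_inv, neg_pow (2 : ℝ) i]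
    have h1 : ((-1 : ℝ) ^ i) * ((-1) ^ i) = 1 := by rw [← mul_pow]; norm_num
    have h2 : ((-1 : ℝ) ^ i)⁻¹ = (-1) ^ i := by
      rw [inv_eq_iff_eq_inv]; exact eq_inv_of_mul_eq_one_left h1
    have h3 : (i.factorial : ℝ) ≠ 0 := by exact_mod_cast i.factorial_ne_zero
    have h4 : (i.factorial : ℝ)⁻¹ * i.factorial = 1 := inv_mul_cancel₀ h3
    rw [h2]
    push_cast
    calc _ = ((i.factorial : ℝ)⁻¹ * i.factorial) * ((-1 : ℝ) ^ i * (-1) ^ i) * ((a.choose i : ℝ)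
          * ((-1) ^ i * 2 ^ i) * ((n.choose k : ℝ) * (k.descFactorial i : ℝ)
            * (n.descFactorial i : ℝ)⁻¹)) := by ring
      _ = _ := by rw [h1, h4, one_mul, one_mul, div_eq_mul_inv]
  · intro i hi
    have hi' : a < i := by simpa using hi
    rw [hpoch a i, Nat.descFactorial_of_lt hi']
    simp

theorem krawtchouk_coeff_even {l r : ℕ} (hl : l ≤ N) (hr : r ≤ N) :
    (krawtchouk (2 * N - 2 * l) (2 * l)).coeff (N - r) = ((2 * N).choose (N + r) : ℝ)
      * ordinaryHypergeometric (-(2 * (l : ℝ))) (-(N : ℝ) + (r : ℝ)) (-(2 * (N : ℝ))) (2 : ℝ) := by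
  rw [← choose_mul_ordinaryHypergeometric (by omega : 2 * l ≤ 2 * N),
    Nat.choose_symm_of_eq_add (show 2 * N = (N + r) + (N - r) by omega)]
  push_cast [Nat.cast_sub hr]
  rw [neg_sub, neg_add_eq_sub]

theorem krawtchouk_coeff_even_swap {j r : ℕ} (hj : j ≤ N) (hr : r ≤ N) :
    (krawtchouk (2 * j) (2 * N - 2 * j)).coeff (N - r)
      = (-1) ^ (N - r) * (((2 * N).choose (N + r) : ℝ)
        * ordinaryHypergeometric (-(2 * (j : ℝ))) (-(N : ℝ) + (r : ℝ)) (-(2 * (N : ℝ)))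
            (2 : ℝ)) := by
  rw [krawtchouk_coeff_swap, krawtchouk_coeff_even hj hr]

/-- Splitting off one factor `1 + X` leaves total degree `2N - 1` and the even exponent `2j`; the
two summands come from the `1` and the `X`. -/
theorem krawtchouk_coeff_odd {j r : ℕ} (hj : j < N) (hr : r ≤ N) (hr1 : 1 ≤ r) :
    (krawtchouk (2 * j + 1) (2 * N - 1 - 2 * j)).coeff (N - r)
      = (-1) ^ (N - r) * (((2 * N - 1).choose (N + r - 1) : ℝ)
          * ordinaryHypergeometric (-(2 * (j : ℝ))) (-(N : ℝ) + (r : ℝ))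
              (-(2 * (N : ℝ)) + 1) (2 : ℝ)
        - ((2 * N - 1).choose (N + r) : ℝ)
          * ordinaryHypergeometric (-(2 * (j : ℝ))) (-(N : ℝ) + (r : ℝ) + 1)
              (-(2 * (N : ℝ)) + 1) (2 : ℝ)) := by
  have hk : ∀ k, (krawtchouk (2 * j) (2 * N - 1 - 2 * j)).coeff k
      = (-1) ^ k * (((2 * N - 1).choose k : ℝ)
        * ordinaryHypergeometric (-(2 * (j : ℝ))) (-(k : ℝ)) (-(2 * (N : ℝ)) + 1) (2 : ℝ)) := by
    intro k
    rw [krawtchouk_coeff_swap, ← choose_mul_ordinaryHypergeometric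
      (by omega : 2 * j ≤ 2 * N - 1)]
    push_cast [Nat.cast_sub (by omega : 1 ≤ 2 * N)]
    rw [neg_sub, neg_add_eq_sub]
  have hmul : krawtchouk (2 * j + 1) (2 * N - 1 - 2 * j)
      = krawtchouk (2 * j) (2 * N - 1 - 2 * j)
        + X * krawtchouk (2 * j) (2 * N - 1 - 2 * j) := by
    simp only [krawtchouk]
    ring
  have h1 : -((N - r : ℕ) : ℝ) = -(N : ℝ) + r := by
    push_cast [Nat.cast_sub hr]
    ring
  have h2 : (2 * N - 1).choose (N - r) = (2 * N - 1).choose (N + r - 1) :=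
    Nat.choose_symm_of_eq_add (by omega)
  rw [hmul, coeff_add, hk, h1, h2]
  rcases Nat.lt_or_ge r N with hlt | hge
  · obtain ⟨k, hk'⟩ : ∃ k, N - r = k + 1 := ⟨N - r - 1, by omega⟩
    have h3 : -(k : ℝ) = -(N : ℝ) + r + 1 := by
      rw [← h1, hk']
      push_cast
      ring
    have h4 : (2 * N - 1).choose k = (2 * N - 1).choose (N + r) :=
      Nat.choose_symm_of_eq_add (by omega)
    rw [hk', coeff_X_mul, hk, h3, h4, pow_succ]
    ring
  -- The `X` part contributes nothing to coefficient `0`, matching `(2N - 1).choose (2N) = 0`.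
  · obtain rfl : r = N := le_antisymm hr hge
    rw [Nat.choose_eq_zero_of_lt (by omega : 2 * r - 1 < r + r)]
    simp

/-! ### Assembly of the closed form -/

/-- Distribution of the chain in terms of the probability of the empty state. -/
theorem IsOccupation.eq_sum_moments {p : ℕ → ℝ → ℝ} (hp : IsOccupation N mu p) (hN : 1 ≤ N)
    {ι : Type*} [Fintype ι] (ρ α : ι → ℝ)
    (hempty : ∀ x, 0 ≤ x → p 0 x = ∑ k, ρ k * Real.exp (α k * x))
    (hα : ∀ m : ℕ, 1 ≤ m → ∀ k, α k + 2 * mu * m ≠ 0) (t : ℝ) (ht : 0 ≤ t) {r : ℕ}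
    (hr : r ≤ N) (E : ℕ → ℝ)
    (hE : ∀ m : ℕ, E m = ∑ k, ρ k * (Real.exp (α k * t) - Real.exp (-(2 * mu * m * t)))
      / (α k + 2 * mu * m)) :
    p r t = 1 / 4 ^ N * (∑ l ∈ Finset.range (N + 1), (N.choose l : ℝ) * (-1) ^ l
        * (Real.exp (-(2 * mu * (2 * l : ℕ) * t))
          * (krawtchouk (2 * N - 2 * l) (2 * l)).coeff (N - r))
      + 2 * mu * N * ∑ j ∈ Finset.range N, ((N - 1).choose j : ℝ) * (-1) ^ (N - 1 - j)
        * ((krawtchouk (2 * j + 1) (2 * N - 1 - 2 * j)).coeff (N - r) * E (2 * N - 1 - 2 * j)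
          - (krawtchouk (2 * j) (2 * N - 2 * j)).coeff (N - r) * E (2 * N - 2 * j))) := by
  rw [eq_sum_krawtchouk p r hr t]
  congr 1
  rw [← sum_krawtchouk_self_mul N fun m =>
    Real.exp (-(2 * mu * m * t)) * (krawtchouk (2 * N - m) m).coeff (N - r)]
  have h2 := sum_krawtchouk_sub_mul hN fun m => (krawtchouk (2 * N - m) m).coeff (N - r) * E m
  have h3 : ∑ j ∈ Finset.range N, ((N - 1).choose j : ℝ) * (-1) ^ (N - 1 - j)
        * ((krawtchouk (2 * j + 1) (2 * N - 1 - 2 * j)).coeff (N - r) * E (2 * N - 1 - 2 * j)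
          - (krawtchouk (2 * j) (2 * N - 2 * j)).coeff (N - r) * E (2 * N - 2 * j))
      = ∑ j ∈ Finset.range N, ((N - 1).choose j : ℝ) * (-1) ^ (N - 1 - j)
        * ((krawtchouk (2 * N - (2 * (N - 1 - j) + 1)) (2 * (N - 1 - j) + 1)).coeff (N - r)
            * E (2 * (N - 1 - j) + 1)
          - (krawtchouk (2 * N - (2 * (N - 1 - j) + 2)) (2 * (N - 1 - j) + 2)).coeff (N - r)
            * E (2 * (N - 1 - j) + 2)) := by
    refine Finset.sum_congr rfl fun j hj => ?_
    have hj' := Finset.mem_range.1 hj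
    rw [show 2 * N - (2 * (N - 1 - j) + 1) = 2 * j + 1 by omega,
      show 2 * N - (2 * (N - 1 - j) + 2) = 2 * j by omega,
      show 2 * (N - 1 - j) + 1 = 2 * N - 1 - 2 * j by omega,
      show 2 * (N - 1 - j) + 2 = 2 * N - 2 * j by omega]
  rw [h3, mul_assoc 2 mu, mul_right_comm 2, mul_comm (2 * _) (mu * _), ← h2, Finset.mul_sum,
    ← Finset.sum_add_distrib]
  refine Finset.sum_congr rfl fun m _ => ?_
  rw [hp.moment ρ α hempty m ((Nat.eq_zero_or_pos m).imp_right (hα m)) t ht, ← hE]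
  ring

/-- Apart from `0`, each root lies strictly between consecutive integer multiples of `-2μ`. -/
theorem root_add_ne_zero (hmu : 0 < mu) {α : Fin (N + 1) → ℝ} (h0 : α 0 = 0)
    (hα : ∀ k : Fin N, -(2 * mu * (2 * (k.val : ℝ) + 2)) < α k.succ ∧
        α k.succ < -(2 * mu * (2 * (k.val : ℝ) + 1)))
    (m : ℕ) (hm : 1 ≤ m) (k : Fin (N + 1)) : α k + 2 * mu * m ≠ 0 := by
  induction k using Fin.cases with
  | zero =>
    rw [h0, zero_add]
    have : (0 : ℝ) < m := by exact_mod_cast hm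
    positivity
  | succ k =>
    intro h
    obtain ⟨h1, h2⟩ := hα k
    have e : α k.succ = -(2 * mu * m) := by linarith
    rw [e, neg_lt_neg_iff] at h1 h2
    have hpos : 0 < 2 * mu := by linarith
    have h1' : (m : ℝ) < 2 * k.val + 2 := lt_of_mul_lt_mul_left h1 hpos.le
    have h2' : (2 * k.val + 1 : ℝ) < m := lt_of_mul_lt_mul_left h2 hpos.le
    have h1'' : m < 2 * k.val + 2 := by exact_mod_cast h1'
    have h2'' : 2 * k.val + 1 < m := by exact_mod_cast h2'
    omega

theorem sum_div_abs_sub {ι : Type*} [Fintype ι] (R α : ι → ℝ) (hα : ∀ k, α k ≤ 0) (c t : ℝ) :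
    ∑ k, R k * (Real.exp (α k * t) - Real.exp (-(c * t))) / (α k + c)
      = -((∑ k, R k * Real.exp (-(|α k| * t)) / (|α k| - c))
        - Real.exp (-(c * t)) * ∑ k, R k / (|α k| - c)) := by
  rw [Finset.mul_sum, ← Finset.sum_sub_distrib, ← Finset.sum_neg_distrib]
  refine Finset.sum_congr rfl fun k _ => ?_
  rw [abs_of_nonpos (hα k), ← neg_add', div_neg, div_neg, neg_mul, neg_neg]
  ring

end Ehrenfest

theorem mainTheorem4 (N d : ℕ) (hN : 1 ≤ N) (lam mu : ℝ) (hmu : 0 < mu) (hlam : lam = mu)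
    (c : Fin d → Fin d → ℝ) (hc : Ehrenfest.IsStochastic c)
    {Ω : Type*} [MeasurableSpace Ω] (ℙ : Measure Ω) [IsProbabilityMeasure ℙ]
    (X : ℝ≥0 → Ω → Ehrenfest.State N d)
    (hX : Ehrenfest.IsMarkovChainWithRates (Ehrenfest.rate N d lam mu c) ℙ X)
    (l₀ : Fin d) (hl₀ : ℙ {ω | X 0 ω = (0, l₀)} ≠ 0) :
    ∃ α β R : Fin (N + 1) → ℝ,
      -- `0 = α₁ > α₂ > ⋯ > α_{N+1}` are the roots of `P`
      StrictAnti α ∧ α 0 = 0 ∧ (∀ x : ℝ, Ehrenfest.polyP N mu x = 0 ↔ ∃ k, α k = x) ∧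
      -- `β_k` is the limit of `P(η) / (η - α_k)` as `η → α_k`
      (∀ k, Tendsto (fun η : ℝ => Ehrenfest.polyP N mu η / (η - α k)) (𝓝[≠] (α k)) (𝓝 (β k))) ∧
      (∀ k, β k = 2 * ∏ s ∈ Finset.univ.erase k, (α k - α s)) ∧
      (∀ k, R k = Ehrenfest.polyQ N mu (α k) / β k) ∧
      -- no denominator vanishes
      (∀ k, β k ≠ 0) ∧
      (∀ k, ∀ j ∈ Finset.range N, |α k| - 2 * mu * (2 * (N : ℝ) - 1 - 2 * (j : ℝ)) ≠ 0 ∧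
        |α k| - 4 * mu * ((N : ℝ) - (j : ℝ)) ≠ 0) ∧
      -- the closed form of `p(r, t)`
      ∀ (t : ℝ≥0) (r : ℕ), 1 ≤ r → r ≤ N →
        Ehrenfest.prob ℙ X l₀ r t
          = 1 / 4 ^ N * ((2 * N).choose (N + r) : ℝ)
              * ∑ l ∈ Finset.range (N + 1), (N.choose l : ℝ)
                  * (-Real.exp (-(4 * mu * (t : ℝ)))) ^ l
                  * ordinaryHypergeometric (-(2 * (l : ℝ))) (-(N : ℝ) + (r : ℝ))
                      (-(2 * (N : ℝ))) (2 : ℝ)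
            + mu * (N : ℝ) / 2 ^ (2 * N - 2) * (-1) ^ (N - r)
              * ∑ j ∈ Finset.range N, ((N - 1).choose j : ℝ) * (-1) ^ (N - 1 - j)
                  * (((2 * N - 1).choose (N + r) : ℝ)
                      * ordinaryHypergeometric (-(2 * (j : ℝ))) (-(N : ℝ) + (r : ℝ) + 1)
                          (-(2 * (N : ℝ)) + 1) (2 : ℝ)
                    - ((2 * N - 1).choose (N + r - 1) : ℝ)
                      * ordinaryHypergeometric (-(2 * (j : ℝ))) (-(N : ℝ) + (r : ℝ))
                          (-(2 * (N : ℝ)) + 1) (2 : ℝ))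
                  * ((∑ k, R k * Real.exp (-(|α k| * (t : ℝ)))
                        / (|α k| - 2 * mu * (2 * (N : ℝ) - 1 - 2 * (j : ℝ))))
                    - Real.exp (-(2 * mu * (t : ℝ) * (2 * (N : ℝ) - 1 - 2 * (j : ℝ))))
                      * ∑ k, R k / (|α k| - 2 * mu * (2 * (N : ℝ) - 1 - 2 * (j : ℝ))))
            + mu * (N : ℝ) / 2 ^ (2 * N - 2) * (-1) ^ (N - r) * ((2 * N).choose (N + r) : ℝ)
              * ∑ j ∈ Finset.range N, ((N - 1).choose j : ℝ) * (-1) ^ (N - 1 - j)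
                  * ordinaryHypergeometric (-(2 * (j : ℝ))) (-(N : ℝ) + (r : ℝ))
                      (-(2 * (N : ℝ))) (2 : ℝ)
                  * ((∑ k, R k * Real.exp (-(|α k| * (t : ℝ)))
                        / (|α k| - 4 * mu * ((N : ℝ) - (j : ℝ))))
                    - Real.exp (-(4 * mu * (t : ℝ) * ((N : ℝ) - (j : ℝ))))
                      * ∑ k, R k / (|α k| - 4 * mu * ((N : ℝ) - (j : ℝ)))) := by
  subst hlam
  obtain ⟨p, hp, hprob⟩ := Ehrenfest.exists_isOccupation hN hc hX l₀ hl₀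
  obtain ⟨α, hanti, hα0, hroot, hint⟩ := Ehrenfest.exists_polyP_roots (N := N) hmu
  have hinj := hanti.injective
  have hnonpos : ∀ k, α k ≤ 0 := fun k => hα0 ▸ hanti.antitone (Fin.zero_le k)
  have hne := Ehrenfest.root_add_ne_zero hmu hα0 hint
  have hβ : ∀ k, (2 * ∏ s ∈ Finset.univ.erase k, (α k - α s)) ≠ 0 := fun k =>
    mul_ne_zero two_ne_zero (Finset.prod_ne_zero_iff.2 fun s hs =>
      sub_ne_zero.2 fun h => Finset.ne_of_mem_erase hs (hinj h.symm))
  have hodd : ∀ j ∈ Finset.range N, 2 * lam * ((2 * N - 1 - 2 * j : ℕ) : ℝ)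
      = 2 * lam * (2 * (N : ℝ) - 1 - 2 * (j : ℝ)) := by
    intro j hj
    have := Finset.mem_range.1 hj
    push_cast [Nat.cast_sub (by omega : 2 * j ≤ 2 * N - 1), Nat.cast_sub (by omega : 1 ≤ 2 * N)]
    ring
  have heven : ∀ j ∈ Finset.range N, 2 * lam * ((2 * N - 2 * j : ℕ) : ℝ)
      = 4 * lam * ((N : ℝ) - (j : ℝ)) := by
    intro j hj
    have := Finset.mem_range.1 hj
    push_cast [Nat.cast_sub (by omega : 2 * j ≤ 2 * N)]
    ring
  refine ⟨α, fun k => 2 * ∏ s ∈ Finset.univ.erase k, (α k - α s),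
    fun k => Ehrenfest.polyQ N lam (α k) / (2 * ∏ s ∈ Finset.univ.erase k, (α k - α s)),
    hanti, hα0, Ehrenfest.polyP_eq_zero_iff hinj hroot, Ehrenfest.tendsto_polyP_div hinj hroot,
    fun _ => rfl, fun _ => rfl, hβ, fun k j hj => ⟨?_, ?_⟩, ?_⟩
  · have hj' := Finset.mem_range.1 hj
    rw [← hodd j hj, abs_of_nonpos (hnonpos k), ← neg_add']
    exact neg_ne_zero.2 (hne _ (by omega) k)
  · have hj' := Finset.mem_range.1 hj
    rw [← heven j hj, abs_of_nonpos (hnonpos k), ← neg_add']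
    exact neg_ne_zero.2 (hne _ (by omega) k)
  intro t r hr1 hr
  set R : Fin (N + 1) → ℝ := fun k => Ehrenfest.polyQ N lam (α k)
    / (2 * ∏ s ∈ Finset.univ.erase k, (α k - α s)) with hR
  -- The weights are `2 * R k` because `β k` carries the leading coefficient `2` of `polyP`.
  have hempty : ∀ x, 0 ≤ x → p 0 x = ∑ k, (2 * R k) * Real.exp (α k * x) := by
    intro x hx
    rw [hp.empty hmu hN hinj hroot x hx]
    refine Finset.sum_congr rfl fun k _ => ?_
    rw [hR]
    have := right_ne_zero_of_mul (hβ k)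
    field_simp
  have hmain := hp.eq_sum_moments hN (fun k => 2 * R k) α hempty hne t t.2 hr
    (fun m => -2 * ((∑ k, R k * Real.exp (-(|α k| * (t : ℝ))) / (|α k| - 2 * lam * m))
      - Real.exp (-(2 * lam * m * (t : ℝ))) * ∑ k, R k / (|α k| - 2 * lam * m)))
    (fun m => by
      rw [neg_mul, ← mul_neg, ← Ehrenfest.sum_div_abs_sub R α hnonpos, Finset.mul_sum]
      exact Finset.sum_congr rfl fun k _ => by ring)
  -- The constant `4` cancels one `2` from the weights `2 * R k` and one from the defect polynomial.
  have hpow : (4 : ℝ) ^ N = 4 * 2 ^ (2 * N - 2) := by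
    rw [show 2 * N - 2 = 2 * (N - 1) by omega, pow_mul, show (2 : ℝ) ^ 2 = 4 by norm_num,
      ← pow_succ', Nat.sub_add_cancel hN]
  rw [hprob, hmain, mul_add, add_assoc]
  congr 1
  · rw [mul_assoc, Finset.mul_sum _ _ ((2 * N).choose (N + r) : ℝ)]
    congr 1
    refine Finset.sum_congr rfl fun l hl => ?_
    rw [Ehrenfest.krawtchouk_coeff_even (Nat.lt_succ_iff.1 (Finset.mem_range.1 hl)) hr,
      neg_pow (Real.exp _) l, ← Real.exp_nat_mul]
    have : -(2 * lam * (2 * l : ℕ) * (t : ℝ)) = l * -(4 * lam * t) := by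
      push_cast
      ring
    rw [this]
    ring
  · rw [hpow, Finset.mul_sum, Finset.mul_sum, Finset.mul_sum, Finset.mul_sum,
      ← Finset.sum_add_distrib]
    refine Finset.sum_congr rfl fun j hj => ?_
    have hj' := Finset.mem_range.1 hj
    rw [Ehrenfest.krawtchouk_coeff_odd hj' hr hr1, Ehrenfest.krawtchouk_coeff_even_swap hj'.le hr]
    simp only [hodd j hj, heven j hj]
    rw [mul_right_comm (2 * lam) (t : ℝ), mul_right_comm (4 * lam) (t : ℝ)]
    generalize (∑ k, R k * Real.exp (-(|α k| * (t : ℝ)))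
      / (|α k| - 2 * lam * (2 * (N : ℝ) - 1 - 2 * (j : ℝ)))) = U₁
    generalize (∑ k, R k / (|α k| - 2 * lam * (2 * (N : ℝ) - 1 - 2 * (j : ℝ)))) = U₂
    generalize (∑ k, R k * Real.exp (-(|α k| * (t : ℝ)))
      / (|α k| - 4 * lam * ((N : ℝ) - (j : ℝ)))) = U₃
    generalize (∑ k, R k / (|α k| - 4 * lam * ((N : ℝ) - (j : ℝ)))) = U₄
    field_simp
    ring
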